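/- For $n\ge 1$ and real parameters let $\langle\cdot\rangle_{\mathrm J_{a,b}}$ be the average with respect to the probability density on $[0,1]^n$ proportional to $\prod_{j}x_j^{\frac{\beta}{2}(b+1)-1}(1-x_j)^{\frac{\beta}{2}(a+1)-1}\prod_{i<j}|x_j-x_i|^{\beta}$, and let $\langle\cdot\rangle_{\mathrm L_b}$ be the average with respect to the probability density on $[0,\infty)^n$ proportional to $\prod_{j}x_j^{\frac{\beta}{2}(b+1)-1}e^{-\beta x_j/2}\prod_{i<j}|x_j-x_i|^{\beta}$. Take $\beta=2$. (i) Let $k\ge 1$ be an integer, $w>1$ real, and $b=n(w-1)+\frac{2}{\beta}-1=n(w-1)$. Then for all large $n$ the moment $M_{\mathrm L_b}^{(2)}(-k,n)=\langle x_1^{-k}+\dots+x_n^{-k}\rangle_{\mathrm L_b}$ is well defined (the weight and the averaged function are integrable), it has an asymptotic expansion $$n^{k-1}M_{\mathrm L_b}^{(2)}(-k,n)\sim\sum_{p=0}^{\infty}\mathcal D^{(2)}_{k,p}(w)\,n^{-p},\qquad n\to\infty,$$ to all orders, and $\mathcal D^{(2)}_{k,1}(w)=0$. (ii) Let $k\ge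 1$ be an integer, $u>1$ real, $\delta\in\{-1,0,1,2\}$, $a=\frac{2}{\beta}\left(1+\frac{\delta}{2}\right)-1=\frac{\delta}{2}$ and $b=n(u-1)$. Then for all large $n$ the moment $M_{\mathrm J_{a,b}}^{(2)}(k,n)=\langle x_1^{k}+\dots+x_n^{k}\rangle_{\mathrm J_{a,b}}$ is well defined (in the same sense), it has an asymptotic expansion $$n^{-1}M_{\mathrm J_{a,b}}^{(2)}(k,n)\sim\sum_{p=0}^{\infty}\mathcal T^{(2,\delta)}_{k,p}(u)\,n^{-p},\qquad n\to\infty,$$ to all orders, its leading coefficient $\mathcal T^{(2,\delta)}_{k,0}(u)$ does not depend on $\delta$ and equals $$\mathcal T_{k,0}(u)=\frac{u}{u+1}-\sum_{j=1}^{k-1}\frac1j\sum_{i=1}^{j}\binom{j}{i}\binom{j}{i-1}\frac{u^{2i}}{(u+1)^{2j+1}},$$ and the first corrections satisfy $$\mathcal T^{(2,\delta)}_{k,1}(u)-\mathcal T^{(2,\delta)}_{k+1,1}(u)=\frac{\delta}{2(u-1)}\left(\frac{u-1}{u+1}\right)^{2k+2}\mathcal T_{k+1,0}(-u),$$ where $\mathcal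 T_{k+1,0}(-u)$ is the rational function above (with $k+1$ in place of $k$) evaluated at $-u$. -/

import Mathlib

open Filter Asymptotics MeasureTheory

noncomputable section

namespace QuantumTransport

/-- `∏_{i < j} |x_j - x_i| ^ β`. -/
def vandermondePow (β : ℝ) {n : ℕ} (x : Fin n → ℝ) : ℝ :=
  ∏ i : Fin n, ∏ j ∈ Finset.Ioi i, |x j - x i| ^ β

/-! ### Jacobi ensemble -/

/-- The domain `[0,1]^n`. -/
def jacobiDomain (n : ℕ) : Set (Fin n → ℝ) :=
  Set.univ.pi fun _ => Set.Icc (0 : ℝ) 1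

/-- The unnormalised Jacobi density. -/
def jacobiWeight (β a b : ℝ) {n : ℕ} (x : Fin n → ℝ) : ℝ :=
  (∏ j, x j ^ (β / 2 * (b + 1) - 1) * (1 - x j) ^ (β / 2 * (a + 1) - 1)) * vandermondePow β x

/-- The normalisation constant of the Jacobi density. -/
def jacobiConst (β a b : ℝ) (n : ℕ) : ℝ :=
  ∫ x in jacobiDomain n, jacobiWeight β a b x

/-- The Jacobi joint probability density on `[0,1]^n`. -/
def jacobiDensity (β a b : ℝ) {n : ℕ} (x : Fin n → ℝ) : ℝ :=
  1 / jacobiConst β a b n * jacobiWeight β a b x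

/-- The `k`-th moment `⟨x_1^k + ... + x_n^k⟩` of the Jacobi ensemble. -/
def jacobiMoment (β a b : ℝ) (k n : ℕ) : ℝ :=
  ∫ x in jacobiDomain n, (∑ j, x j ^ k) * jacobiDensity β a b x

/-! ### Laguerre ensemble -/

/-- The domain `[0,∞)^n`. -/
def laguerreDomain (n : ℕ) : Set (Fin n → ℝ) :=
  Set.univ.pi fun _ => Set.Ici (0 : ℝ)

/-- The unnormalised Laguerre density. -/
def laguerreWeight (β b : ℝ) {n : ℕ} (x : Fin n → ℝ) : ℝ :=
  (∏ j, x j ^ (β / 2 * (b + 1) - 1) * Real.exp (-(β * x j / 2))) * vandermondePow β x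

/-- The normalisation constant of the Laguerre density. -/
def laguerreConst (β b : ℝ) (n : ℕ) : ℝ :=
  ∫ x in laguerreDomain n, laguerreWeight β b x

/-- The Laguerre joint probability density on `[0,∞)^n`. -/
def laguerreDensity (β b : ℝ) {n : ℕ} (x : Fin n → ℝ) : ℝ :=
  1 / laguerreConst β b n * laguerreWeight β b x

/-- The moment `⟨x_1^k + ... + x_n^k⟩`, `k ∈ ℤ`, of the Laguerre ensemble. -/
def laguerreMoment (β b : ℝ) (k : ℤ) (n : ℕ) : ℝ :=
  ∫ x in laguerreDomain n, (∑ j, x j ^ k) * laguerreDensity β b x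

/-! ### Asymptotic expansions in powers of `1/n` -/

/-- `f n ∼ ∑_p c_p n^{-p}` as `n → ∞`, in the sense of Poincaré. -/
def HasAsymptoticExpansion (f : ℕ → ℝ) (c : ℕ → ℝ) : Prop :=
  ∀ P : ℕ, (fun n : ℕ => f n - ∑ p ∈ Finset.range (P + 1), c p * (n : ℝ) ^ (-(p : ℤ)))
    =o[atTop] fun n : ℕ => (n : ℝ) ^ (-(P : ℤ))

/-- The coefficients of the asymptotic expansion of `f` in powers of `1/n`:
`c_p = lim n^p (f n - ∑_{q < p} c_q n^{-q})`. If `f` has an expansion, these are its (unique)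
coefficients. -/
def asymptoticCoeff (f : ℕ → ℝ) : ℕ → ℝ
  | p => limUnder atTop fun n : ℕ =>
      (n : ℝ) ^ p * (f n - ∑ q : Fin p, asymptoticCoeff f q * (n : ℝ) ^ (-(q : ℤ)))
decreasing_by exact q.isLt

/-- The parameter `a` of the Jacobi ensemble in terms of `β` and `δ`. -/
def jacobiA (β δ : ℝ) : ℝ := 2 / β * (1 + δ / 2) - 1

/-- The parameter `b` of the Jacobi ensemble, `b = m - n = n (u - 1)`. -/
def jacobiB (u : ℝ) (n : ℕ) : ℝ := n * (u - 1)

/-- The parameter `b` of the Laguerre ensemble. -/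
def laguerreB (β w : ℝ) (n : ℕ) : ℝ := n * (w - 1) + 2 / β - 1

/-- `n^{-1} M(k, n)` for the transmission eigenvalues. -/
def transmissionSeq (β δ : ℝ) (k : ℕ) (u : ℝ) (n : ℕ) : ℝ :=
  (n : ℝ)⁻¹ * jacobiMoment β (jacobiA β δ) (jacobiB u n) k n

/-- `n^{k-1} M(-k, n)` for the proper delay times. -/
def delaySeq (β : ℝ) (k : ℕ) (w : ℝ) (n : ℕ) : ℝ :=
  (n : ℝ) ^ ((k : ℤ) - 1) * laguerreMoment β (laguerreB β w n) (-(k : ℤ)) n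

/-- The coefficients `𝒯_{k,p}^{(β,δ)}(u)`. -/
def transmissionCoeff (β δ : ℝ) (k p : ℕ) (u : ℝ) : ℝ :=
  asymptoticCoeff (transmissionSeq β δ k u) p

/-- The coefficients `𝒟_{k,p}^{(β)}(w)`. -/
def delayCoeff (β : ℝ) (k p : ℕ) (w : ℝ) : ℝ :=
  asymptoticCoeff (delaySeq β k w) p

/-- `Δ𝒯_{k,p}^{(β,δ)}(u) = 𝒯_{k,p}^{(β,δ)}(u) - 𝒯_{k+1,p}^{(β,δ)}(u)`. -/
def transmissionDiffCoeff (β δ : ℝ) (k p : ℕ) (u : ℝ) : ℝ :=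
  transmissionCoeff β δ k p u - transmissionCoeff β δ (k + 1) p u

/-- The explicit rational function of `u` giving the leading coefficient `𝒯_{k,0}(u)`, `k ≥ 1`
(also evaluated at negative arguments). -/
def transmissionLeading (k : ℕ) (u : ℝ) : ℝ :=
  u / (u + 1) - ∑ j ∈ Finset.Ico 1 k, 1 / (j : ℝ) *
    ∑ i ∈ Finset.Icc 1 j, (j.choose i : ℝ) * (j.choose (i - 1) : ℝ) *
      (u ^ (2 * i) / (u + 1) ^ (2 * j + 1))

end QuantumTransport

end

/-! At β = 2 the density is a product of one-particle weights times a squared Vandermonde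
determinant. Andréief's identity turns the normalisation into a determinant of one-particle moments,
and the unnormalised k-th moment into a sum of such determinants with one row shifted by k. For both
weights the one-particle moment of order l + j factors as g(l) P_j(l), with g a Gamma quotient and
deg P_j < n. Interpolation at the nodes 0, …, n-1 writes the shifted row in terms of the old rows,
so the average equals Σ_i g(i+k)/g(i) · ℓ_i(i+k), with ℓ_i the Lagrange basis; for delay times k
becomes -k (`integral_sum_zpow_mul_weight`).

Since ℓ_i vanishes at the other nodes, only k boundary terms survive. After scaling by ε = 1/n they
are the residues of one rational function at k nodes which coalesce as ε → 0. A fixed circle around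
these nodes gives a contour integral analytic in ε, whose Taylor series at 0 is the expansion
(`hasAsymptoticExpansion_of_circleIntegral`).

At ε = 0 the integrand is K^k for a rational kernel K. For delay times the integrand is ∏_r K(z -
εr), so its ε-derivative at 0 is a multiple of K^(k-1) K'; this is exact, and the first correction
vanishes. For transmission it is ∏_r K(z + ε(r+1)) perturbed by a = δ/2 in one denominator, and only
-k a K^k/(z+u) survives integration.

With t = (z-1)/(z+u) one has K = (1+ut)(1+u/t)/(1+u)², so every integral is a coefficient of a
Laurent polynomial, given by A_k = Σ C(k,i)² u^(2i) and B_k = Σ C(k,i) C(k,i+1) u^(2i+1). The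
leading coefficient of index k+1 is u(A_k + B_k)/(u+1)^(2k+1), and the difference of first
corrections contains A_k - B_k. As A_k is even and B_k is odd in u, the latter is the former at -u.
-/

noncomputable section

namespace QuantumTransport

/-! ### Andréief's identity and linear statistics -/

section Andreief

variable {ι : Type*} [Fintype ι] [DecidableEq ι]

/-- Andréief's identity, with integrability. -/
theorem integrable_det_mul_det {μ : Measure ℝ} [SigmaFinite μ] {f g : ι → ℝ → ℝ}
    (hfg : ∀ i j, Integrable (fun x => f i x * g j x) μ) :
    Integrable (fun x : ι → ℝ => (Matrix.of fun i j => f i (x j)).det *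
      (Matrix.of fun i j => g i (x j)).det) (Measure.pi fun _ => μ) ∧
    ∫ x : ι → ℝ, (Matrix.of fun i j => f i (x j)).det * (Matrix.of fun i j => g i (x j)).det
      ∂(Measure.pi fun _ => μ) =
      (Fintype.card ι).factorial * (Matrix.of fun i j => ∫ x, f i x * g j x ∂μ).det := by
  have hexp : (fun x : ι → ℝ => (Matrix.of fun i j => f i (x j)).det *
      (Matrix.of fun i j => g i (x j)).det) = fun x => ∑ σ : Equiv.Perm ι, ∑ τ : Equiv.Perm ι,
      ((Equiv.Perm.sign σ : ℤ) : ℝ) * ((Equiv.Perm.sign τ : ℤ) : ℝ) *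
        ∏ j, (f (σ j) (x j) * g (τ j) (x j)) := by
    funext x
    rw [Matrix.det_apply', Matrix.det_apply', Finset.sum_mul_sum]
    refine Finset.sum_congr rfl fun σ _ => Finset.sum_congr rfl fun τ _ => ?_
    simp only [Matrix.of_apply, Finset.prod_mul_distrib]
    ring
  have hint : ∀ σ τ : Equiv.Perm ι, Integrable (fun x : ι → ℝ =>
      ((Equiv.Perm.sign σ : ℤ) : ℝ) * ((Equiv.Perm.sign τ : ℤ) : ℝ) *
        ∏ j, (f (σ j) (x j) * g (τ j) (x j))) (Measure.pi fun _ => μ) := fun σ τ =>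
    (Integrable.fintype_prod (f := fun j y => f (σ j) y * g (τ j) y)
      fun j => hfg (σ j) (τ j)).const_mul _
  rw [hexp]
  refine ⟨integrable_finsetSum _ fun σ _ => integrable_finsetSum _ fun τ _ => hint σ τ, ?_⟩
  rw [integral_finsetSum _ fun σ _ => integrable_finsetSum _ fun τ _ => hint σ τ]
  have hσ : ∀ σ : Equiv.Perm ι, ∫ x : ι → ℝ, ∑ τ : Equiv.Perm ι,
      ((Equiv.Perm.sign σ : ℤ) : ℝ) * ((Equiv.Perm.sign τ : ℤ) : ℝ) *
        ∏ j, (f (σ j) (x j) * g (τ j) (x j)) ∂(Measure.pi fun _ => μ) =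
      (Matrix.of fun i j => ∫ x, f i x * g j x ∂μ).det := by
    intro σ
    rw [integral_finsetSum _ fun τ _ => hint σ τ, ← Matrix.det_transpose, Matrix.det_apply']
    -- The term depends on σ and τ only through τσ⁻¹, so every σ contributes the same determinant;
    -- this produces the factorial.
    refine Fintype.sum_equiv (Equiv.mulRight σ⁻¹) _ _ fun τ => ?_
    rw [integral_const_mul, integral_fintype_prod_eq_prod (f := fun j y => f (σ j) y * g (τ j) y),
      ← Equiv.prod_comp σ fun i => (Matrix.of fun i j => ∫ x, f i x * g j x ∂μ).transpose
        (Equiv.mulRight σ⁻¹ τ i) i]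
    simp only [Equiv.coe_mulRight, Equiv.Perm.sign_mul, Equiv.Perm.sign_symm, Matrix.transpose_apply,
      Matrix.of_apply, Equiv.Perm.mul_apply, Equiv.Perm.inv_def, Equiv.symm_apply_apply]
    push_cast
    ring
  rw [Finset.sum_congr rfl fun σ _ => hσ σ, Finset.sum_const, Finset.card_univ, Fintype.card_perm,
    nsmul_eq_mul]

/-- Multiplying a determinant by the trace of a diagonal matrix. -/
theorem sum_mul_det {R : Type*} [CommRing R] (d : ι → R) (A : Matrix ι ι R) :
    (∑ j, d j) * A.det = ∑ i, (A.updateRow i fun j => d j * A i j).det := by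
  simp only [Matrix.det_apply', Finset.mul_sum]
  rw [Finset.sum_comm]
  refine Finset.sum_congr rfl fun σ _ => ?_
  have h : ∀ i, ∏ j, A.updateRow (σ i) (fun j => d j * A (σ i) j) (σ j) j
      = d i * ∏ j, A (σ j) j := by
    intro i
    rw [← Finset.mul_prod_erase _ _ (Finset.mem_univ i), Matrix.updateRow_self,
      ← Finset.mul_prod_erase _ (fun j => A (σ j) j) (Finset.mem_univ i), mul_assoc]
    refine congrArg _ (congrArg _ (Finset.prod_congr rfl fun j hj => ?_))
    rw [Matrix.updateRow_ne (σ.injective.ne (Finset.ne_of_mem_erase hj))]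
  rw [Finset.sum_mul]
  refine Fintype.sum_equiv σ _ _ fun i => ?_
  rw [h]
  ring

theorem integrable_sum_mul_det_mul_det {μ : Measure ℝ} [SigmaFinite μ] {f g : ι → ℝ → ℝ}
    {h : ℝ → ℝ} (hfg : ∀ i j, Integrable (fun x => f i x * g j x) μ)
    (hhfg : ∀ i j, Integrable (fun x => h x * f i x * g j x) μ) :
    Integrable (fun x : ι → ℝ => (∑ j, h (x j)) * ((Matrix.of fun i j => f i (x j)).det *
      (Matrix.of fun i j => g i (x j)).det)) (Measure.pi fun _ => μ) ∧
    ∫ x : ι → ℝ, (∑ j, h (x j)) * ((Matrix.of fun i j => f i (x j)).det *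
        (Matrix.of fun i j => g i (x j)).det) ∂(Measure.pi fun _ => μ) =
      (Fintype.card ι).factorial * ∑ i, ((Matrix.of fun i j => ∫ x, f i x * g j x ∂μ).updateRow i
        fun j => ∫ x, h x * f i x * g j x ∂μ).det := by
  -- The family F i has its i-th member multiplied by h; by `sum_mul_det` the linear statistic
  -- splits into one Andréief integral for each such family.
  set F : ι → ι → ℝ → ℝ := fun i => Function.update f i (fun x => h x * f i x) with hF
  have hFint : ∀ i i' j, Integrable (fun x => F i i' x * g j x) μ := by
    intro i i' j
    rcases eq_or_ne i' i with rfl | hne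
    · simpa [hF] using hhfg i' j
    · simpa [hF, hne] using hfg i' j
  have key := fun i => integrable_det_mul_det (hFint i)
  have hexp : (fun x : ι → ℝ => (∑ j, h (x j)) * ((Matrix.of fun i j => f i (x j)).det *
      (Matrix.of fun i j => g i (x j)).det)) = fun x => ∑ i,
        (Matrix.of fun i' j => F i i' (x j)).det * (Matrix.of fun i j => g i (x j)).det := by
    funext x
    rw [← mul_assoc, sum_mul_det, Finset.sum_mul]
    refine Finset.sum_congr rfl fun i _ => congrArg (fun A : Matrix ι ι ℝ => A.det * _) ?_
    ext i' j
    rcases eq_or_ne i' i with rfl | hne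
    · simp [hF]
    · simp [hF, hne]
  rw [hexp]
  refine ⟨integrable_finsetSum _ fun i _ => (key i).1, ?_⟩
  rw [integral_finsetSum _ fun i _ => (key i).1, Finset.mul_sum]
  refine Finset.sum_congr rfl fun i _ => ?_
  rw [(key i).2]
  refine congrArg (fun A : Matrix ι ι ℝ => _ * A.det) ?_
  ext i' j
  rcases eq_or_ne i' i with rfl | hne
  · simp [hF]
  · simp [hF, hne]

end Andreief

/-! ### Determinants of factorised moments and interpolation -/

open Polynomial in
-- Interpolation at the nodes v is exact on degree below n, so the new row is a combination of the
-- rows of M with the same coefficients in every column. All rows except the i-th drop out of the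
-- determinant.
theorem det_updateRow_eq_mul_det {n : ℕ} {P : Fin n → ℝ[X]} (hP : ∀ j, (P j).degree < n)
    {v : Fin n → ℝ} (hv : Function.Injective v) {g : ℝ → ℝ} (hg : ∀ i, g (v i) ≠ 0)
    (M : Matrix (Fin n) (Fin n) ℝ) (hM : ∀ i j, M i j = g (v i) * (P j).eval (v i)) (i : Fin n)
    (y : ℝ) :
    (M.updateRow i fun j => g y * (P j).eval y).det =
      g y / g (v i) * (Lagrange.basis Finset.univ v i).eval y * M.det := by
  have hrow : (fun j => g y * (P j).eval y) =
      ∑ m, (g y / g (v m) * (Lagrange.basis Finset.univ v m).eval y) • M m := by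
    funext j
    have h := Lagrange.eq_interpolate (s := Finset.univ) (f := P j) hv.injOn (by simpa using hP j)
    rw [Finset.sum_apply]
    conv_lhs => rw [h, Lagrange.interpolate_apply, eval_finsetSum, Finset.mul_sum]
    refine Finset.sum_congr rfl fun m _ => ?_
    rw [Pi.smul_apply, smul_eq_mul, hM, eval_mul, eval_C]
    field_simp [hg m]
  rw [hrow, Matrix.det_updateRow_sum, smul_eq_mul]

open Polynomial in
-- The evaluation matrix is a Vandermonde matrix times the coefficient matrix. Nonvanishing at one
-- choice of points makes the coefficient matrix invertible, hence gives nonvanishing at all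
-- distinct nodes; the test points may thus be chosen for convenience.
theorem det_eval_ne_zero_of_det_eval_ne_zero {n : ℕ} {P : Fin n → ℝ[X]}
    (hP : ∀ j, (P j).degree < n) {v s : Fin n → ℝ} (hv : Function.Injective v)
    (hs : (Matrix.of fun i j => (P j).eval (s i)).det ≠ 0) :
    (Matrix.of fun i j => (P j).eval (v i)).det ≠ 0 := by
  have hmul : ∀ w : Fin n → ℝ, (Matrix.of fun i j => (P j).eval (w i)) =
      Matrix.vandermonde w * Matrix.of fun i j : Fin n => (P j).coeff i := by
    intro w
    ext i j
    have hn : (P j).natDegree < n := by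
      rcases eq_or_ne (P j) 0 with h | h
      · simpa [h] using j.pos
      · exact (natDegree_lt_iff_degree_lt h).2 (hP j)
    rw [Matrix.of_apply, eval_eq_sum_range' hn, Matrix.mul_apply, Finset.sum_range]
    exact Finset.sum_congr rfl fun m _ => by simp [Matrix.vandermonde_apply, mul_comm]
  rw [hmul, Matrix.det_mul] at hs ⊢
  exact mul_ne_zero (Matrix.det_vandermonde_ne_zero_iff.2 hv) (right_ne_zero_of_mul hs)

theorem vandermondePow_two {n : ℕ} (x : Fin n → ℝ) :
    vandermondePow 2 x = (Matrix.vandermonde x).det ^ 2 := by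
  simp only [vandermondePow, Matrix.det_vandermonde, ← Finset.prod_pow]
  refine Finset.prod_congr rfl fun i _ => Finset.prod_congr rfl fun j _ => ?_
  rw [Real.rpow_ofNat, sq_abs]

open Polynomial in
/-- Moments of an ensemble with density `∏ φ(x_j) ∏_{i<j} |x_j - x_i|²`, when the moments of `φ`
factorise. -/
theorem integral_sum_zpow_mul_weight {n : ℕ} {μ : Measure ℝ} [SigmaFinite μ] {φ g : ℝ → ℝ} {k : ℤ}
    {P : Fin n → ℝ[X]} (hP : ∀ j, (P j).degree < n) {s : Fin n → ℝ}
    (hs : (Matrix.of fun i j => (P j).eval (s i)).det ≠ 0) (h0 : ∀ᵐ x ∂μ, x ≠ 0)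
    (hint : ∀ l : ℤ, min 0 k ≤ l → Integrable (fun x => x ^ l * φ x) μ)
    (hm : ∀ l : ℤ, min 0 k ≤ l → ∀ j : Fin n,
      ∫ x, x ^ (l + (j : ℕ)) * φ x ∂μ = g l * (P j).eval (l : ℝ))
    (hg : ∀ i : Fin n, g (i : ℕ) ≠ 0) :
    Integrable (fun x : Fin n → ℝ => (∏ j, φ (x j)) * vandermondePow 2 x)
      (Measure.pi fun _ => μ) ∧
    Integrable (fun x : Fin n → ℝ => (∑ j, x j ^ k) * ((∏ j, φ (x j)) * vandermondePow 2 x))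
      (Measure.pi fun _ => μ) ∧
    ∫ x : Fin n → ℝ, (∏ j, φ (x j)) * vandermondePow 2 x ∂(Measure.pi fun _ => μ) ≠ 0 ∧
    ∫ x : Fin n → ℝ, (∑ j, x j ^ k) * ((∏ j, φ (x j)) * vandermondePow 2 x)
        ∂(Measure.pi fun _ => μ) =
      (∑ i : Fin n, g ((i : ℕ) + k) / g (i : ℕ) *
        (Lagrange.basis Finset.univ (fun i : Fin n => ((i : ℕ) : ℝ)) i).eval ((i : ℕ) + k : ℝ)) *
      ∫ x : Fin n → ℝ, (∏ j, φ (x j)) * vandermondePow 2 x ∂(Measure.pi fun _ => μ) := by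
  set v : Fin n → ℝ := fun i => ((i : ℕ) : ℝ) with hv
  have hvinj : Function.Injective v := fun i j h => Fin.ext (Nat.cast_injective (R := ℝ) h)
  have hW : ∀ x : Fin n → ℝ, (∏ j, φ (x j)) * vandermondePow 2 x =
      (Matrix.of fun i j : Fin n => x j ^ (i : ℕ) * φ (x j)).det *
        (Matrix.of fun i j : Fin n => x j ^ (i : ℕ)).det := by
    intro x
    have h1 : (Matrix.of fun i j : Fin n => x j ^ (i : ℕ) * φ (x j)).det =
        (∏ j, φ (x j)) * (Matrix.vandermonde x).det := by
      rw [← Matrix.det_transpose (Matrix.vandermonde x), ← Matrix.det_mul_row]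
      congr 1
      ext i j
      simp [Matrix.vandermonde_apply, mul_comm]
    have h2 : (Matrix.of fun i j : Fin n => x j ^ (i : ℕ)).det = (Matrix.vandermonde x).det := by
      rw [← Matrix.det_transpose]
      rfl
    rw [h1, h2, vandermondePow_two]
    ring
  have e1 : ∀ i j : Fin n, (fun x : ℝ => x ^ (i : ℕ) * φ x * x ^ (j : ℕ)) =
      fun x => x ^ (((i : ℕ) : ℤ) + ((j : ℕ) : ℤ)) * φ x := by
    intro i j
    funext x
    rw [← Nat.cast_add, zpow_natCast, pow_add]
    ring
  -- Only almost everywhere: k may be negative, and adding integer exponents requires x ≠ 0.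
  have e2 : ∀ i j : Fin n, (fun x : ℝ => x ^ k * (x ^ (i : ℕ) * φ x) * x ^ (j : ℕ)) =ᵐ[μ]
      fun x => x ^ ((((i : ℕ) : ℤ) + k) + ((j : ℕ) : ℤ)) * φ x := by
    intro i j
    filter_upwards [h0] with x hx
    rw [zpow_add₀ hx, zpow_add₀ hx, zpow_natCast, zpow_natCast]
    ring
  have hi1 : ∀ i j : Fin n, Integrable (fun x : ℝ => x ^ (i : ℕ) * φ x * x ^ (j : ℕ)) μ := by
    intro i j
    rw [e1]
    exact hint _ (by omega)
  have hi2 : ∀ i j : Fin n, Integrable (fun x : ℝ => x ^ k * (x ^ (i : ℕ) * φ x) * x ^ (j : ℕ)) μ :=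
    fun i j => (hint _ (by omega)).congr (e2 i j).symm
  have hm1 : ∀ i j : Fin n, ∫ x, x ^ (i : ℕ) * φ x * x ^ (j : ℕ) ∂μ =
      g (v i) * (P j).eval (v i) := by
    intro i j
    rw [e1, hm _ (by omega), Int.cast_natCast]
  have hm2 : ∀ i j : Fin n, ∫ x, x ^ k * (x ^ (i : ℕ) * φ x) * x ^ (j : ℕ) ∂μ =
      g (v i + k) * (P j).eval (v i + k) := by
    intro i j
    rw [integral_congr_ae (e2 i j), hm _ (by omega)]
    push_cast
    rfl
  simp only [hW]
  have A := integrable_det_mul_det hi1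
  have B := integrable_sum_mul_det_mul_det hi1 hi2
  set M : Matrix (Fin n) (Fin n) ℝ :=
    Matrix.of fun i j : Fin n => ∫ x, x ^ (i : ℕ) * φ x * x ^ (j : ℕ) ∂μ with hMdef
  have hM : ∀ i j, M i j = g (v i) * (P j).eval (v i) := fun i j => hm1 i j
  have hMdet : M.det ≠ 0 := by
    have : M.det = (∏ i, g (v i)) * (Matrix.of fun i j => (P j).eval (v i)).det := by
      rw [← Matrix.det_mul_column]
      congr 1
      ext i j
      exact hM i j
    rw [this]
    exact mul_ne_zero (Finset.prod_ne_zero_iff.2 fun i _ => hg i)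
      (det_eval_ne_zero_of_det_eval_ne_zero hP hvinj hs)
  have hfac : ((Fintype.card (Fin n)).factorial : ℝ) ≠ 0 := by positivity
  refine ⟨A.1, B.1, ?_, ?_⟩
  · rw [A.2]
    exact mul_ne_zero hfac hMdet
  · rw [B.2, A.2]
    simp only [hm2]
    rw [Finset.sum_congr rfl fun i _ => det_updateRow_eq_mul_det hP hvinj (fun i => hg i) M hM i
      (v i + k), ← Finset.sum_mul]
    ring

/-! ### Exact finite-n formulas for both ensembles -/

theorem integrable_and_integral_rpow_mul_one_sub_rpow {p q : ℝ} (hp : 0 < p) (hq : 0 < q) :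
    Integrable (fun x : ℝ => x ^ (p - 1) * (1 - x) ^ (q - 1)) (volume.restrict (Set.Ioo 0 1)) ∧
    ∫ x in Set.Ioo (0 : ℝ) 1, x ^ (p - 1) * (1 - x) ^ (q - 1) =
      Real.Gamma p * Real.Gamma q / Real.Gamma (p + q) := by
  have hre : ∀ x ∈ Set.Ioo (0 : ℝ) 1,
      ((x : ℂ) ^ ((p : ℂ) - 1) * (1 - (x : ℂ)) ^ ((q : ℂ) - 1)).re =
        x ^ (p - 1) * (1 - x) ^ (q - 1) := by
    intro x hx
    have h1 : (x : ℂ) ^ ((p : ℂ) - 1) = ((x ^ (p - 1) : ℝ) : ℂ) := by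
      rw [Complex.ofReal_cpow hx.1.le]
      push_cast
      rfl
    have h2 : (1 - (x : ℂ)) ^ ((q : ℂ) - 1) = (((1 - x) ^ (q - 1) : ℝ) : ℂ) := by
      rw [Complex.ofReal_cpow (by linarith [hx.2])]
      push_cast
      rfl
    rw [h1, h2, ← Complex.ofReal_mul, Complex.ofReal_re]
  have hc : IntegrableOn (fun x : ℝ => (x : ℂ) ^ ((p : ℂ) - 1) * (1 - (x : ℂ)) ^ ((q : ℂ) - 1))
      (Set.Ioo 0 1) := by
    have h := Complex.betaIntegral_convergent (u := p) (v := q) (by simpa) (by simpa)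
    rw [intervalIntegrable_iff_integrableOn_Ioc_of_le (by simp)] at h
    exact h.mono_set Set.Ioo_subset_Ioc_self
  have hae : ∀ᵐ x : ℝ ∂volume.restrict (Set.Ioo 0 1),
      ((x : ℂ) ^ ((p : ℂ) - 1) * (1 - (x : ℂ)) ^ ((q : ℂ) - 1)).re =
        x ^ (p - 1) * (1 - x) ^ (q - 1) :=
    (ae_restrict_iff' measurableSet_Ioo).2 (Eventually.of_forall hre)
  refine ⟨hc.re.congr hae, ?_⟩
  have hb := ProbabilityTheory.beta_eq_betaIntegralReal p q hp hq
  rw [ProbabilityTheory.beta] at hb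
  rw [hb, Complex.betaIntegral, intervalIntegral.integral_of_le zero_le_one,
    integral_Ioc_eq_integral_Ioo, ← integral_congr_ae hae]
  exact integral_re hc

theorem Gamma_add_natCast {x : ℝ} (hx : 0 < x) (k : ℕ) :
    Real.Gamma (x + k) = Real.Gamma x * ∏ r ∈ Finset.range k, (x + r) := by
  induction k with
  | zero => simp
  | succ k ih =>
    rw [Finset.prod_range_succ, ← mul_assoc, ← ih, Nat.cast_succ, ← add_assoc,
      Real.Gamma_add_one (by positivity), mul_comm]

open Polynomial in
theorem degree_prod_X_add_C {s : Finset ℕ} (c : ℕ → ℝ) :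
    (∏ r ∈ s, (X + C (c r) : ℝ[X])).degree = s.card := by
  rw [degree_prod]
  simp

open Polynomial in
-- At the point -b - i the product over r < j contains a vanishing factor as soon as i < j, so the
-- matrix is triangular.
theorem exists_det_eval_prod_ne_zero {n : ℕ} {b : ℝ} {Q : Fin n → ℝ[X]}
    (hQ : ∀ i : Fin n, (Q i).eval (-b - i : ℝ) ≠ 0) :
    (Matrix.of fun i j : Fin n => ((∏ r ∈ Finset.range j, (X + C (b + r))) * Q j).eval
      (-b - i : ℝ)).det ≠ 0 := by
  rw [Matrix.det_of_isLowerTriangular]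
  · refine Finset.prod_ne_zero_iff.2 fun i _ => ?_
    rw [Matrix.of_apply, eval_mul, eval_prod]
    refine mul_ne_zero (Finset.prod_ne_zero_iff.2 fun r hr => ?_) (hQ i)
    have : (r : ℝ) < (i : ℕ) := by exact_mod_cast Finset.mem_range.1 hr
    simp only [eval_add, eval_X, eval_C]
    intro h
    linarith
  · intro i j hij
    have hij' : (i : ℕ) < j := hij
    rw [Matrix.of_apply, eval_mul, eval_prod,
      Finset.prod_eq_zero (Finset.mem_range.2 hij') (by simp), zero_mul]

open Polynomial in
theorem laguerre_moment_formula {b : ℝ} {k n : ℕ} (hb : (k : ℝ) < b + 1) :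
    IntegrableOn (laguerreWeight 2 b (n := n)) (laguerreDomain n) ∧
    IntegrableOn (fun x : Fin n → ℝ => (∑ j, x j ^ (-(k : ℤ))) * laguerreDensity 2 b x)
      (laguerreDomain n) ∧
    laguerreMoment 2 b (-(k : ℤ)) n = ∑ i : Fin n,
      (∏ r ∈ Finset.range k, ((i : ℕ) + b - r : ℝ))⁻¹ *
        (Lagrange.basis Finset.univ (fun i : Fin n => ((i : ℕ) : ℝ)) i).eval
          ((i : ℕ) - k : ℝ) := by
  set μ : Measure ℝ := volume.restrict (Set.Ioi 0) with hμ
  have hdom : (volume : Measure (Fin n → ℝ)).restrict (laguerreDomain n) =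
      Measure.pi fun _ => μ := by
    rw [laguerreDomain, volume_pi, Measure.restrict_pi_pi, hμ,
      Measure.restrict_congr_set (Ioi_ae_eq_Ici (a := (0 : ℝ)))]
  set φ : ℝ → ℝ := fun x => x ^ b * Real.exp (-x) with hφ
  have hw : ∀ x : Fin n → ℝ, laguerreWeight 2 b x = (∏ j, φ (x j)) * vandermondePow 2 x := by
    intro x
    have e1 : (2 : ℝ) / 2 * (b + 1) - 1 = b := by ring
    have e2 : ∀ y : ℝ, (2 : ℝ) * y / 2 = y := fun y => by ring
    simp only [laguerreWeight, e1, e2, hφ]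
  have hφl : ∀ l : ℤ, (fun x : ℝ => x ^ l * φ x) =ᵐ[μ]
      fun x => Real.exp (-x) * x ^ ((l : ℝ) + b + 1 - 1) := by
    intro l
    refine (ae_restrict_iff' measurableSet_Ioi).2 (Eventually.of_forall fun x hx => ?_)
    have hx' : (0 : ℝ) < x := hx
    simp only [hφ]
    rw [add_sub_cancel_right, Real.rpow_add hx', Real.rpow_intCast]
    ring
  have hl : ∀ l : ℤ, min 0 (-(k : ℤ)) ≤ l → 0 < (l : ℝ) + b + 1 := by
    intro l hl
    have : -(k : ℤ) ≤ l := by omega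
    have : -(k : ℝ) ≤ l := by exact_mod_cast this
    linarith
  -- P_j(l) is the rising factorial Γ(l+j+b+1)/Γ(l+b+1); the trailing factor 1 matches the shape of
  -- `exists_det_eval_prod_ne_zero`.
  set P : Fin n → ℝ[X] := fun j => (∏ r ∈ Finset.range j, (X + C ((b + 1) + r))) * 1 with hPdef
  have key := integral_sum_zpow_mul_weight (n := n) (μ := μ) (φ := φ)
    (g := fun l => Real.Gamma (l + b + 1)) (k := -(k : ℤ)) (P := P)
    (fun j => by
      simp only [hPdef, mul_one]
      rw [degree_prod_X_add_C fun r : ℕ => b + 1 + r, Finset.card_range]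
      exact_mod_cast j.isLt)
    (exists_det_eval_prod_ne_zero fun i => by simp)
    ((ae_restrict_iff' measurableSet_Ioi).2 (Eventually.of_forall fun x hx => ne_of_gt hx))
    (fun l h => (Real.GammaIntegral_convergent (hl l h)).congr (hφl l).symm)
    (fun l h j => by
      rw [integral_congr_ae (hφl _), Int.cast_add, Int.cast_natCast,
        ← Real.Gamma_eq_integral (by
          have := hl l h
          have : (0 : ℝ) ≤ (j : ℕ) := by positivity
          linarith),
        show (l : ℝ) + (j : ℕ) + b + 1 = l + b + 1 + (j : ℕ) by ring, Gamma_add_natCast (hl l h)]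
      simp only [hPdef, mul_one, eval_prod, eval_add, eval_X, eval_C]
      exact congrArg _ (Finset.prod_congr rfl fun r _ => by ring))
    (fun i => (Real.Gamma_pos_of_pos (by
      have : (0 : ℝ) ≤ k := by positivity
      have : (0 : ℝ) ≤ (i : ℕ) := by positivity
      linarith)).ne')
  obtain ⟨k1, k2, k3, k4⟩ := key
  simp only [← hw] at k1 k2 k3 k4
  have hconst : laguerreConst 2 b n = ∫ x : Fin n → ℝ, laguerreWeight 2 b x
      ∂(Measure.pi fun _ => μ) := by
    rw [laguerreConst, hdom]
  have hdens : ∀ x : Fin n → ℝ, (∑ j, x j ^ (-(k : ℤ))) * laguerreDensity 2 b x =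
      1 / laguerreConst 2 b n * ((∑ j, x j ^ (-(k : ℤ))) * laguerreWeight 2 b x) := by
    intro x
    rw [laguerreDensity]
    ring
  refine ⟨by rw [IntegrableOn, hdom]; exact k1, ?_, ?_⟩
  · simp only [hdens]
    rw [IntegrableOn, hdom]
    exact k2.const_mul _
  · simp only [laguerreMoment, hdens]
    rw [hdom, integral_const_mul, k4, hconst, mul_comm, mul_assoc, mul_one_div_cancel k3, mul_one]
    refine Finset.sum_congr rfl fun i _ => ?_
    have hpos : 0 < (i : ℕ) - (k : ℝ) + b + 1 := by
      have : (0 : ℝ) ≤ (i : ℕ) := by positivity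
      linarith
    push_cast
    rw [show ((i : ℕ) : ℝ) + b + 1 = (i : ℕ) - (k : ℝ) + b + 1 + k by ring,
      Gamma_add_natCast hpos, ← sub_eq_add_neg, div_mul_cancel_left₀ (Real.Gamma_pos_of_pos hpos).ne',
      ← Finset.prod_range_reflect]
    refine congrArg (fun y => y⁻¹ * _) (Finset.prod_congr rfl fun r hr => ?_)
    have hr' : r + 1 ≤ k := Finset.mem_range.1 hr
    rw [show k - 1 - r = k - (r + 1) by omega, Nat.cast_sub hr']
    push_cast
    ring

open Polynomial in
theorem jacobi_moment_formula {a b : ℝ} {k n : ℕ} (ha : -1 < a) (hb : -1 < b) :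
    IntegrableOn (jacobiWeight 2 a b (n := n)) (jacobiDomain n) ∧
    IntegrableOn (fun x : Fin n → ℝ => (∑ j, x j ^ k) * jacobiDensity 2 a b x)
      (jacobiDomain n) ∧
    jacobiMoment 2 a b k n = ∑ i : Fin n,
      (∏ r ∈ Finset.range k, ((i : ℕ) + b + (r + 1) : ℝ) / ((i : ℕ) + n + a + b + (r + 1))) *
        (Lagrange.basis Finset.univ (fun i : Fin n => ((i : ℕ) : ℝ)) i).eval
          ((i : ℕ) + k : ℝ) := by
  set μ : Measure ℝ := volume.restrict (Set.Ioo 0 1) with hμ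
  have hdom : (volume : Measure (Fin n → ℝ)).restrict (jacobiDomain n) =
      Measure.pi fun _ => μ := by
    rw [jacobiDomain, volume_pi, Measure.restrict_pi_pi, hμ,
      Measure.restrict_congr_set (Ioo_ae_eq_Icc (a := (0 : ℝ)) (b := 1))]
  set φ : ℝ → ℝ := fun x => x ^ b * (1 - x) ^ a with hφ
  have hw : ∀ x : Fin n → ℝ, jacobiWeight 2 a b x = (∏ j, φ (x j)) * vandermondePow 2 x := by
    intro x
    have e1 : ∀ c : ℝ, (2 : ℝ) / 2 * (c + 1) - 1 = c := fun c => by ring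
    simp only [jacobiWeight, e1, hφ]
  have hφl : ∀ l : ℤ, (fun x : ℝ => x ^ l * φ x) =ᵐ[μ]
      fun x => x ^ ((l : ℝ) + b + 1 - 1) * (1 - x) ^ (a + 1 - 1) := by
    intro l
    refine (ae_restrict_iff' measurableSet_Ioo).2 (Eventually.of_forall fun x hx => ?_)
    simp only [hφ]
    rw [add_sub_cancel_right, add_sub_cancel_right, Real.rpow_add hx.1, Real.rpow_intCast]
    ring
  have hl : ∀ l : ℤ, min 0 (k : ℤ) ≤ l → 0 < (l : ℝ) + b + 1 := by
    intro l hl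
    have : (0 : ℤ) ≤ l := by omega
    have : (0 : ℝ) ≤ l := by exact_mod_cast this
    linarith
  have ha' : 0 < a + 1 := by linarith
  -- The Beta moment has Γ(l+j+a+b+2) in its denominator. Replacing it by the common Γ(l+n+a+b+1),
  -- the largest case j = n-1, costs the second product and gives every P_j degree n-1.
  set P : Fin n → ℝ[X] := fun j => (∏ r ∈ Finset.range j, (X + C ((b + 1) + r))) *
    ∏ r ∈ Finset.Ico (j : ℕ) (n - 1), (X + C (a + b + 2 + r)) with hPdef
  have key := integral_sum_zpow_mul_weight (n := n) (μ := μ) (φ := φ)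
    (g := fun l => Real.Gamma (a + 1) * Real.Gamma (l + b + 1) / Real.Gamma (l + n + a + b + 1))
    (k := (k : ℤ)) (P := P)
    (fun j => by
      simp only [hPdef]
      rw [degree_mul, degree_prod_X_add_C fun r : ℕ => b + 1 + r, Finset.card_range,
        degree_prod_X_add_C fun r : ℕ => a + b + 2 + r, Nat.card_Ico]
      have := j.isLt
      exact_mod_cast (by omega : (j : ℕ) + (n - 1 - j) < n))
    (exists_det_eval_prod_ne_zero fun i => by
      rw [eval_prod]
      refine Finset.prod_ne_zero_iff.2 fun r hr => ?_
      have : ((i : ℕ) : ℝ) ≤ r := by exact_mod_cast (Finset.mem_Ico.1 hr).1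
      simp only [eval_add, eval_X, eval_C]
      intro h
      linarith)
    ((ae_restrict_iff' measurableSet_Ioo).2 (Eventually.of_forall fun x hx => ne_of_gt hx.1))
    (fun l h => (integrable_and_integral_rpow_mul_one_sub_rpow (hl l h) ha').1.congr (hφl l).symm)
    (fun l h j => by
      have hlb := hl l h
      have hj := j.isLt
      have h1 : ((n - 1 : ℕ) : ℝ) = n - 1 := by
        rw [Nat.cast_sub (by omega), Nat.cast_one]
      have hjn : 0 < (l : ℝ) + b + 1 + (a + 1) := by linarith
      have hjpos : 0 < (l : ℝ) + b + 1 + (a + 1) + (j : ℕ) := by positivity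
      rw [integral_congr_ae (hφl _), Int.cast_add, Int.cast_natCast,
        (integrable_and_integral_rpow_mul_one_sub_rpow (by
          have : (0 : ℝ) ≤ (j : ℕ) := by positivity
          linarith) ha').2,
        show (l : ℝ) + (j : ℕ) + b + 1 = l + b + 1 + (j : ℕ) by ring, Gamma_add_natCast hlb,
        show (l : ℝ) + b + 1 + (j : ℕ) + (a + 1) = l + b + 1 + (a + 1) + (j : ℕ) by ring,
        show (l : ℝ) + n + a + b + 1 = l + b + 1 + (a + 1) + (j : ℕ) + ((n - 1 - j : ℕ) : ℝ) by
          rw [Nat.cast_sub (by omega), h1]; ring,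
        Gamma_add_natCast hjpos]
      simp only [hPdef, eval_mul, eval_prod, eval_add, eval_X, eval_C]
      rw [Finset.prod_Ico_eq_prod_range]
      have e1 : ∏ r ∈ Finset.range (n - 1 - j), ((l : ℝ) + (a + b + 2 + ((j + r : ℕ) : ℝ))) =
          ∏ r ∈ Finset.range (n - 1 - j), ((l : ℝ) + b + 1 + (a + 1) + (j : ℕ) + r) :=
        Finset.prod_congr rfl fun r _ => by push_cast; ring
      have e2 : ∏ r ∈ Finset.range (j : ℕ), ((l : ℝ) + (b + 1 + r)) =
          ∏ r ∈ Finset.range (j : ℕ), ((l : ℝ) + b + 1 + r) :=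
        Finset.prod_congr rfl fun r _ => by ring
      have h3 : ∏ r ∈ Finset.range (n - 1 - j), ((l : ℝ) + b + 1 + (a + 1) + (j : ℕ) + r) ≠ 0 :=
        Finset.prod_ne_zero_iff.2 fun r _ => by positivity
      have h4 := (Real.Gamma_pos_of_pos hjpos).ne'
      rw [e1, e2]
      field_simp)
    (fun i => by
      have hi : (0 : ℝ) ≤ (i : ℕ) := by positivity
      have hn : (1 : ℝ) ≤ n := by exact_mod_cast i.pos
      have h1 : 0 < ((i : ℕ) : ℝ) + b + 1 := by linarith
      have h2 : 0 < ((i : ℕ) : ℝ) + n + a + b + 1 := by linarith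
      have := Real.Gamma_pos_of_pos h1
      have := Real.Gamma_pos_of_pos h2
      have := Real.Gamma_pos_of_pos ha'
      positivity)
  obtain ⟨k1, k2, k3, k4⟩ := key
  simp only [← hw, zpow_natCast, Int.cast_natCast] at k1 k2 k3 k4
  have hconst : jacobiConst 2 a b n = ∫ x : Fin n → ℝ, jacobiWeight 2 a b x
      ∂(Measure.pi fun _ => μ) := by
    rw [jacobiConst, hdom]
  have hdens : ∀ x : Fin n → ℝ, (∑ j, x j ^ k) * jacobiDensity 2 a b x =
      1 / jacobiConst 2 a b n * ((∑ j, x j ^ k) * jacobiWeight 2 a b x) := by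
    intro x
    rw [jacobiDensity]
    ring
  refine ⟨by rw [IntegrableOn, hdom]; exact k1, ?_, ?_⟩
  · simp only [hdens]
    rw [IntegrableOn, hdom]
    exact k2.const_mul _
  · simp only [jacobiMoment, hdens]
    rw [hdom, integral_const_mul, k4, hconst, mul_comm, mul_assoc, mul_one_div_cancel k3, mul_one]
    refine Finset.sum_congr rfl fun i _ => ?_
    have hi : (0 : ℝ) ≤ (i : ℕ) := by positivity
    have hn : (1 : ℝ) ≤ n := by exact_mod_cast i.pos
    have hpos : 0 < (i : ℕ) + b + 1 := by linarith
    have hpos' : 0 < (i : ℕ) + n + a + b + 1 := by linarith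
    rw [show ((i : ℕ) : ℝ) + k + b + 1 = (i : ℕ) + b + 1 + k by ring,
      show ((i : ℕ) : ℝ) + k + n + a + b + 1 = (i : ℕ) + n + a + b + 1 + k by ring,
      Gamma_add_natCast hpos, Gamma_add_natCast hpos', Finset.prod_div_distrib]
    have e1 : ∀ c : ℝ, ∏ r ∈ Finset.range k, (c + (r + 1 : ℝ)) =
        ∏ r ∈ Finset.range k, (c + 1 + r) := fun c => Finset.prod_congr rfl fun r _ => by ring
    rw [e1, e1]
    have h1 := (Real.Gamma_pos_of_pos hpos).ne'
    have h2 := (Real.Gamma_pos_of_pos hpos').ne'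
    have h3 := (Real.Gamma_pos_of_pos ha').ne'
    have h4 : ∏ r ∈ Finset.range k, (((i : ℕ) : ℝ) + n + a + b + 1 + r) ≠ 0 :=
      Finset.prod_ne_zero_iff.2 fun r _ => by positivity
    field_simp

/-! ### The Lagrange basis at shifted integer nodes -/

/-- Both sides are the product of the n + k consecutive factors from y - n + 1 to y + k, split at
different places. -/
theorem prod_shift_mul_prod {R : Type*} [CommRing R] (y : R) (k n : ℕ) :
    (∏ j ∈ Finset.range n, (y + k - j)) * ∏ s ∈ Finset.range k, (y - n + (s + 1)) =
      (∏ j ∈ Finset.range n, (y - j)) * ∏ s ∈ Finset.range k, (y + (s + 1)) := by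
  induction n with
  | zero => simp
  | succ n ih =>
    have h : (y + k - n) * ∏ s ∈ Finset.range k, (y - (n + 1) + (s + 1)) =
        (y - n) * ∏ s ∈ Finset.range k, (y - n + (s + 1)) := by
      have h1 := Finset.prod_range_succ (fun s : ℕ => y - n + (s : R)) k
      rw [Finset.prod_range_succ'] at h1
      calc (y + k - n) * ∏ s ∈ Finset.range k, (y - (n + 1) + (s + 1))
          = (∏ s ∈ Finset.range k, (y - n + (s : R))) * (y - n + k) := by
            rw [mul_comm]
            exact congrArg₂ _ (Finset.prod_congr rfl fun s _ => by ring) (by ring)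
        _ = _ := by
            rw [← h1, mul_comm]
            push_cast
            rw [add_zero]
    rw [Finset.prod_range_succ, Finset.prod_range_succ, Nat.cast_succ, mul_assoc, h]
    linear_combination (y - n) * ih

open Polynomial in
/-- If `N(X + c) D(X) = N(X) E(X)` for the nodal polynomial `N` of some nodes and `D(v_i) = 0`,
then the Lagrange basis polynomial at `v_i + c` is `E(v_i) / (c D'(v_i))`. -/
theorem eval_basis_add_eq {ι : Type*} [DecidableEq ι] {F : Type*} [Field F] {S : Finset ι}
    {v : ι → F} (hv : Set.InjOn v S) {i : ι} (hi : i ∈ S) {c : F} (hc : c ≠ 0) {N' D E : F[X]}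
    (hN' : N'.eval (v i) = (Lagrange.nodal S v).eval (v i + c))
    (hNDE : N' * D = Lagrange.nodal S v * E) (hD : D.eval (v i) = 0)
    (hD' : (derivative D).eval (v i) ≠ 0) :
    (Lagrange.basis S v i).eval (v i + c) = E.eval (v i) / (c * (derivative D).eval (v i)) := by
  -- Differentiating at v_i, where both D and the nodal polynomial vanish, leaves one term on each
  -- side; this compares N(v_i + c) with N'(v_i).
  have h := congrArg (fun p : F[X] => (derivative p).eval (v i)) hNDE
  simp only [derivative_mul, eval_add, eval_mul, hD, Lagrange.eval_nodal_at_node hi, hN'] at h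
  have hd : (derivative (Lagrange.nodal S v)).eval (v i) ≠ 0 := by
    have := Lagrange.nodalWeight_ne_zero hv hi
    rwa [Lagrange.nodalWeight_eq_eval_derivative_nodal hi, ne_eq, inv_eq_zero] at this
  rw [Lagrange.eval_basis_not_at_node hi (by simpa using hc),
    Lagrange.nodalWeight_eq_eval_derivative_nodal hi, add_sub_cancel_left]
  field_simp
  linear_combination h

theorem injective_fin_cast (n : ℕ) : Function.Injective fun i : Fin n => ((i : ℕ) : ℝ) :=
  fun _ _ h => Fin.ext (Nat.cast_injective (R := ℝ) h)

theorem prod_erase_natCast_sub_ne_zero {k m : ℕ} :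
    ∏ s ∈ (Finset.range k).erase m, ((s : ℝ) - m) ≠ 0 :=
  Finset.prod_ne_zero_iff.2 fun _ hs =>
    sub_ne_zero.2 (Nat.cast_injective.ne (Finset.ne_of_mem_erase hs))

open Polynomial in
theorem nodal_univ_fin (n : ℕ) :
    Lagrange.nodal Finset.univ (fun i : Fin n => ((i : ℕ) : ℝ)) =
      ∏ j ∈ Finset.range n, (X - (j : ℝ[X])) := by
  rw [Lagrange.nodal_eq, Finset.prod_range]
  simp

open Polynomial in
theorem eval_basis_add_natCast {k n m : ℕ} (hm : m < k) (hkn : k ≤ n) :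
    (Lagrange.basis Finset.univ (fun i : Fin n => ((i : ℕ) : ℝ)) ⟨n - (m + 1), by omega⟩).eval
        ((n : ℝ) - (m + 1) + k) =
      (∏ s ∈ Finset.range k, ((n : ℝ) - (m + 1) + (s + 1))) /
        (k * ∏ s ∈ (Finset.range k).erase m, ((s : ℝ) - m)) := by
  have hk : (k : ℝ) ≠ 0 := by
    have : k ≠ 0 := by omega
    exact_mod_cast this
  have hcast : ((n - (m + 1) : ℕ) : ℝ) = n - (m + 1) := by
    rw [Nat.cast_sub (by omega)]
    push_cast
    rfl
  -- The roots of D are the top nodes n-1, …, n-k, those which a shift by k moves out of {0, …,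
  -- n-1}.
  set D : ℝ[X] := Lagrange.nodal (Finset.range k) fun s : ℕ => (n : ℝ) - (s + 1) with hD
  have hDe : D = ∏ s ∈ Finset.range k, (X - (n : ℝ[X]) + ((s : ℝ[X]) + 1)) := by
    rw [hD, Lagrange.nodal_eq]
    refine Finset.prod_congr rfl fun s _ => ?_
    simp only [map_sub, map_add, map_natCast, map_one]
    ring
  have hmk : m ∈ Finset.range k := Finset.mem_range.2 hm
  have hDder : (derivative D).eval ((n : ℝ) - (m + 1)) =
      ∏ s ∈ (Finset.range k).erase m, ((s : ℝ) - m) := by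
    have := Lagrange.eval_nodal_derivative_eval_node_eq (v := fun s : ℕ => (n : ℝ) - (s + 1)) hmk
    rw [hD, this, Lagrange.eval_nodal]
    exact Finset.prod_congr rfl fun s _ => by ring
  have key := eval_basis_add_eq (S := Finset.univ) (v := fun i : Fin n => ((i : ℕ) : ℝ))
    (injective_fin_cast n).injOn (i := ⟨n - (m + 1), by omega⟩) (Finset.mem_univ _) hk
    (N' := ∏ j ∈ Finset.range n, (X + (k : ℝ[X]) - (j : ℝ[X]))) (D := D)
    (E := ∏ s ∈ Finset.range k, (X + ((s : ℝ[X]) + 1)))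
    (by
      rw [nodal_univ_fin, eval_prod, eval_prod]
      simp)
    (by rw [hDe, nodal_univ_fin, prod_shift_mul_prod])
    (by
      simp only [hcast]
      exact Lagrange.eval_nodal_at_node (v := fun s : ℕ => (n : ℝ) - (s + 1)) hmk)
    (by
      simp only [hcast]
      rw [hDder]
      exact prod_erase_natCast_sub_ne_zero)
  simp only [hcast, hDder] at key
  rw [key, eval_prod]
  simp

open Polynomial in
theorem eval_basis_sub_natCast {k n m : ℕ} (hm : m < k) (hkn : k ≤ n) :
    (Lagrange.basis Finset.univ (fun i : Fin n => ((i : ℕ) : ℝ)) ⟨m, by omega⟩).eval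
        ((m : ℝ) - k) =
      (∏ s ∈ Finset.range k, ((m : ℝ) - n - s)) /
        (-k * ∏ s ∈ (Finset.range k).erase m, ((m : ℝ) - s)) := by
  have hk : (k : ℝ) ≠ 0 := by
    have : k ≠ 0 := by omega
    exact_mod_cast this
  have hrefl : ∀ y : ℝ[X], ∏ s ∈ Finset.range k, (y - k + ((s : ℝ[X]) + 1)) =
      ∏ s ∈ Finset.range k, (y - (s : ℝ[X])) := by
    intro y
    rw [← Finset.prod_range_reflect]
    refine Finset.prod_congr rfl fun s hs => ?_
    have hs' : s + 1 ≤ k := Finset.mem_range.1 hs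
    rw [show k - 1 - s = k - (s + 1) by omega, Nat.cast_sub hs']
    push_cast
    ring
  set D : ℝ[X] := Lagrange.nodal (Finset.range k) fun s : ℕ => (s : ℝ) with hD
  have hDe : D = ∏ s ∈ Finset.range k, (X - (s : ℝ[X])) := by
    rw [hD, Lagrange.nodal_eq]
    simp
  have hmk : m ∈ Finset.range k := Finset.mem_range.2 hm
  have hDder : (derivative D).eval (m : ℝ) =
      ∏ s ∈ (Finset.range k).erase m, ((m : ℝ) - s) := by
    have := Lagrange.eval_nodal_derivative_eval_node_eq (v := fun s : ℕ => (s : ℝ)) hmk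
    rw [hD, this, Lagrange.eval_nodal]
  have key := eval_basis_add_eq (S := Finset.univ) (v := fun i : Fin n => ((i : ℕ) : ℝ))
    (injective_fin_cast n).injOn (i := ⟨m, by omega⟩) (Finset.mem_univ _) (neg_ne_zero.2 hk)
    (N' := ∏ j ∈ Finset.range n, (X - (k : ℝ[X]) - (j : ℝ[X]))) (D := D)
    (E := ∏ s ∈ Finset.range k, (X - (n : ℝ[X]) - (s : ℝ[X])))
    (by
      rw [nodal_univ_fin, eval_prod, eval_prod]
      simp [sub_eq_add_neg])
    (by
      have h := prod_shift_mul_prod (X - (k : ℝ[X])) k n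
      rw [hrefl, hDe.symm] at h
      rw [nodal_univ_fin, ← h, ← hrefl]
      refine congrArg₂ _ (Finset.prod_congr rfl fun j _ => by ring)
        (Finset.prod_congr rfl fun j _ => by ring))
    (Lagrange.eval_nodal_at_node (v := fun s : ℕ => (s : ℝ)) hmk)
    (by
      rw [hDder]
      exact Finset.prod_ne_zero_iff.2 fun _ hs =>
        sub_ne_zero.2 (Nat.cast_injective.ne (Finset.ne_of_mem_erase hs).symm))
  rw [hDder, ← sub_eq_add_neg] at key
  rw [key, eval_prod]
  simp

theorem sum_mul_basis_add {k n : ℕ} (hk : 0 < k) (hkn : k ≤ n) (G : ℝ → ℝ) :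
    ∑ i : Fin n, G (i : ℕ) *
      (Lagrange.basis Finset.univ (fun i : Fin n => ((i : ℕ) : ℝ)) i).eval ((i : ℕ) + k : ℝ) =
    ∑ m ∈ Finset.range k, G (n - (m + 1)) *
      ((∏ s ∈ Finset.range k, ((n : ℝ) - (m + 1) + (s + 1))) /
        (k * ∏ s ∈ (Finset.range k).erase m, ((s : ℝ) - m))) := by
  rw [Finset.sum_range]
  symm
  -- The surviving index is i = n - (m+1). Any other i has i + k among the remaining nodes, where
  -- its basis polynomial vanishes.
  refine Fintype.sum_of_injective (fun m : Fin k => (⟨n - (m + 1), by omega⟩ : Fin n))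
    (fun m m' h => ?_) _ _ (fun i hi => ?_) fun m => ?_
  · have h' := congrArg Fin.val h
    simp only at h'
    exact Fin.ext (by omega)
  · have hik : (i : ℕ) + k < n := by
      by_contra hcon
      exact hi ⟨⟨n - (i + 1), by omega⟩, Fin.ext (by simp only; omega)⟩
    have hne : i ≠ (⟨i + k, hik⟩ : Fin n) := fun h => by
      have := congrArg Fin.val h
      simp only at this
      omega
    have := Lagrange.eval_basis_of_ne (s := Finset.univ)
      (v := fun i : Fin n => ((i : ℕ) : ℝ)) hne (Finset.mem_univ _)
    simp only [Nat.cast_add] at this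
    rw [this, mul_zero]
  · rw [← eval_basis_add_natCast m.isLt hkn]
    simp only
    rw [Nat.cast_sub (by omega)]
    push_cast
    rfl

theorem sum_mul_basis_sub {k n : ℕ} (hk : 0 < k) (hkn : k ≤ n) (G : ℝ → ℝ) :
    ∑ i : Fin n, G (i : ℕ) *
      (Lagrange.basis Finset.univ (fun i : Fin n => ((i : ℕ) : ℝ)) i).eval ((i : ℕ) - k : ℝ) =
    ∑ m ∈ Finset.range k, G m *
      ((∏ s ∈ Finset.range k, ((m : ℝ) - n - s)) /
        (-k * ∏ s ∈ (Finset.range k).erase m, ((m : ℝ) - s))) := by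
  rw [Finset.sum_range]
  symm
  -- Here i - k leaves the node set exactly when i < k, so the lowest k indices survive.
  refine Fintype.sum_of_injective (fun m : Fin k => (⟨m, by omega⟩ : Fin n))
    (fun m m' h => ?_) _ _ (fun i hi => ?_) fun m => ?_
  · have h' := congrArg Fin.val h
    simp only at h'
    exact Fin.ext (by omega)
  · have hik : k ≤ i := by
      by_contra hcon
      exact hi ⟨⟨i, by omega⟩, rfl⟩
    have hne : i ≠ (⟨i - k, by omega⟩ : Fin n) := fun h => by
      have := congrArg Fin.val h
      simp only at this
      omega
    have := Lagrange.eval_basis_of_ne (s := Finset.univ)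
      (v := fun i : Fin n => ((i : ℕ) : ℝ)) hne (Finset.mem_univ _)
    simp only [Nat.cast_sub hik] at this
    rw [this, mul_zero]
  · rw [← eval_basis_sub_natCast m.isLt hkn]

/-! ### Rescaling the sums by 1/n -/

theorem prod_const_mul_of_card {ι : Type*} {s : Finset ι} {d : ℕ} (hd : s.card = d) (c : ℝ)
    (f : ι → ℝ) : c ^ d * ∏ i ∈ s, f i = ∏ i ∈ s, c * f i := by
  rw [Finset.prod_mul_distrib, Finset.prod_const, hd]

/-- All powers of n cancel, and n enters only through 1/n. The right side is a residue sum at the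
nodes 1 - (m+1)/n, ready to become a contour integral. -/
theorem transmissionSeq_eq {k n : ℕ} {u δ : ℝ} (hk : 0 < k) (hkn : k ≤ n) (hu : 1 < u)
    (hδ : -2 < δ) :
    transmissionSeq 2 δ k u n = 1 / k * ∑ m ∈ Finset.range k,
      (∏ r ∈ Finset.range k, ((1 - (n : ℝ)⁻¹ * (m + 1)) + u - 1 + (n : ℝ)⁻¹ * (r + 1)) *
          ((1 - (n : ℝ)⁻¹ * (m + 1)) + (n : ℝ)⁻¹ * (r + 1)) /
          ((1 - (n : ℝ)⁻¹ * (m + 1)) + u + (n : ℝ)⁻¹ * (δ / 2 + (r + 1)))) /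
        ∏ s ∈ (Finset.range k).erase m,
          ((1 - (n : ℝ)⁻¹ * (m + 1)) - (1 - (n : ℝ)⁻¹ * (s + 1))) := by
  have hn : (n : ℝ) ≠ 0 := by
    have : n ≠ 0 := by omega
    exact_mod_cast this
  have hn0 : (0 : ℝ) ≤ n := by positivity
  have ha : jacobiA 2 δ = δ / 2 := by
    rw [jacobiA]
    ring
  rw [transmissionSeq, ha, (jacobi_moment_formula (by linarith) (by
    rw [jacobiB]
    nlinarith)).2.2, sum_mul_basis_add hk hkn fun z => ∏ r ∈ Finset.range k,
      (z + jacobiB u n + (r + 1) : ℝ) / (z + n + δ / 2 + jacobiB u n + (r + 1)),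
    Finset.mul_sum, Finset.mul_sum]
  refine Finset.sum_congr rfl fun m hm => ?_
  have hk' : (k : ℝ) ≠ 0 := by exact_mod_cast hk.ne'
  set ε : ℝ := (n : ℝ)⁻¹ with hε
  set ζ : ℝ := 1 - ε * (m + 1) with hζ
  have hnε : (n : ℝ) * ε = 1 := mul_inv_cancel₀ hn
  have hz : (n : ℝ) - (m + 1) = n * ζ := by
    rw [hζ]
    linear_combination (m + 1 : ℝ) * hnε
  have e1 : ∏ r ∈ Finset.range k, ((n : ℝ) - (m + 1) + jacobiB u n + (r + 1)) /
      ((n : ℝ) - (m + 1) + n + δ / 2 + jacobiB u n + (r + 1)) =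
      ∏ r ∈ Finset.range k, (ζ + u - 1 + ε * (r + 1)) / (ζ + u + ε * (δ / 2 + (r + 1))) := by
    refine Finset.prod_congr rfl fun r _ => ?_
    rw [hz, jacobiB, ← mul_div_mul_left _ (ζ + u + ε * (δ / 2 + (r + 1))) hn]
    congr 1
    · linear_combination (-(r + 1 : ℝ)) * hnε
    · linear_combination (-(δ / 2 + (r + 1) : ℝ)) * hnε
  have e2 : ∏ s ∈ Finset.range k, ((n : ℝ) - (m + 1) + (s + 1)) =
      n ^ k * ∏ s ∈ Finset.range k, (ζ + ε * (s + 1)) := by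
    rw [prod_const_mul_of_card (Finset.card_range k)]
    refine Finset.prod_congr rfl fun r _ => ?_
    rw [hz]
    linear_combination (-(r + 1 : ℝ)) * hnε
  have e3 : ∏ s ∈ (Finset.range k).erase m, ((s : ℝ) - m) =
      n ^ (k - 1) * ∏ s ∈ (Finset.range k).erase m, (ζ - (1 - ε * (s + 1))) := by
    have hc : ((Finset.range k).erase m).card = k - 1 := by
      rw [Finset.card_erase_of_mem hm, Finset.card_range]
    rw [prod_const_mul_of_card hc]
    refine Finset.prod_congr rfl fun s _ => ?_
    rw [hζ]
    linear_combination (m - s : ℝ) * hnε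
  have h3 : ∏ s ∈ (Finset.range k).erase m, (ζ - (1 - ε * (s + 1))) ≠ 0 := by
    have := prod_erase_natCast_sub_ne_zero (k := k) (m := m)
    rw [e3] at this
    exact right_ne_zero_of_mul this
  rw [e1, e2, e3, Finset.prod_congr (g := fun r : ℕ => (ζ + u - 1 + ε * ((r : ℝ) + 1)) /
    (ζ + u + ε * (δ / 2 + ((r : ℝ) + 1))) * (ζ + ε * ((r : ℝ) + 1))) rfl
    fun r _ => mul_div_right_comm _ _ _, Finset.prod_mul_distrib]
  obtain ⟨j, rfl⟩ : ∃ j, k = j + 1 := ⟨k - 1, by omega⟩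
  rw [Nat.add_sub_cancel, pow_succ (n : ℝ) j]
  generalize ∏ r ∈ Finset.range (j + 1), (ζ + u - 1 + ε * ((r : ℝ) + 1)) /
    (ζ + u + ε * (δ / 2 + ((r : ℝ) + 1))) = A
  generalize ∏ s ∈ Finset.range (j + 1), (ζ + ε * ((s : ℝ) + 1)) = B
  generalize ∏ s ∈ (Finset.range (j + 1)).erase m, (ζ - (1 - ε * ((s : ℝ) + 1))) = D
  rw [hε]
  field_simp

/-- The normalisation n^(k-1) is the one that cancels all powers of n; the residue nodes are now
m/n, and the bound on k makes the negative moment finite. -/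
theorem delaySeq_eq {k n : ℕ} {w : ℝ} (hk : 0 < k) (hkn : k ≤ n) (hw : (k : ℝ) < n * (w - 1) + 1) :
    delaySeq 2 k w n = -1 / k * ∑ m ∈ Finset.range k,
      (∏ r ∈ Finset.range k, ((n : ℝ)⁻¹ * m - 1 - (n : ℝ)⁻¹ * r) /
          ((n : ℝ)⁻¹ * m + w - 1 - (n : ℝ)⁻¹ * r)) /
        ∏ s ∈ (Finset.range k).erase m, ((n : ℝ)⁻¹ * m - (n : ℝ)⁻¹ * s) := by
  have hn : (n : ℝ) ≠ 0 := by
    have : n ≠ 0 := by omega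
    exact_mod_cast this
  have hb : laguerreB 2 w n = n * (w - 1) := by
    rw [laguerreB]
    ring
  rw [delaySeq, hb, (laguerre_moment_formula hw).2.2, sum_mul_basis_sub hk hkn fun z =>
      (∏ r ∈ Finset.range k, (z + n * (w - 1) - r : ℝ))⁻¹,
    Finset.mul_sum, Finset.mul_sum]
  refine Finset.sum_congr rfl fun m hm => ?_
  have hk' : (k : ℝ) ≠ 0 := by exact_mod_cast hk.ne'
  set ε : ℝ := (n : ℝ)⁻¹ with hε
  have hnε : (n : ℝ) * ε = 1 := mul_inv_cancel₀ hn
  have e1 : ∏ r ∈ Finset.range k, ((m : ℝ) + n * (w - 1) - r) =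
      n ^ k * ∏ r ∈ Finset.range k, (ε * m + w - 1 - ε * r) := by
    rw [prod_const_mul_of_card (Finset.card_range k)]
    refine Finset.prod_congr rfl fun r _ => ?_
    linear_combination (r - m : ℝ) * hnε
  have e2 : ∏ s ∈ Finset.range k, ((m : ℝ) - n - s) =
      n ^ k * ∏ s ∈ Finset.range k, (ε * m - 1 - ε * s) := by
    rw [prod_const_mul_of_card (Finset.card_range k)]
    refine Finset.prod_congr rfl fun r _ => ?_
    linear_combination (r - m : ℝ) * hnε
  have e3 : ∏ s ∈ (Finset.range k).erase m, ((m : ℝ) - s) =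
      n ^ (k - 1) * ∏ s ∈ (Finset.range k).erase m, (ε * m - ε * s) := by
    have hc : ((Finset.range k).erase m).card = k - 1 := by
      rw [Finset.card_erase_of_mem hm, Finset.card_range]
    rw [prod_const_mul_of_card hc]
    refine Finset.prod_congr rfl fun s _ => ?_
    linear_combination (s - m : ℝ) * hnε
  rw [e1, e2, e3, Finset.prod_div_distrib]
  obtain ⟨j, rfl⟩ : ∃ j, k = j + 1 := ⟨k - 1, by omega⟩
  rw [Nat.add_sub_cancel, show (((j + 1 : ℕ) : ℤ) - 1) = (j : ℤ) by push_cast; ring, zpow_natCast,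
    mul_inv]
  generalize ∏ r ∈ Finset.range (j + 1), (ε * (m : ℝ) + w - 1 - ε * r) = B
  generalize ∏ s ∈ Finset.range (j + 1), (ε * (m : ℝ) - 1 - ε * s) = A
  generalize ∏ s ∈ (Finset.range (j + 1)).erase m, (ε * (m : ℝ) - ε * s) = D
  field_simp

/-! ### Contour integrals and asymptotic expansions -/

open Polynomial in
-- Interpolating the constant 1 at the nodes is the partial fraction decomposition of 1/∏(z - v_s);
-- Cauchy's formula applies to each fraction.
theorem circleIntegral_div_prod_sub {c : ℂ} {R : ℝ} (hR : 0 < R) {k : ℕ} (hk : 0 < k) {f : ℂ → ℂ}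
    (hf : DifferentiableOn ℂ f (Metric.closedBall c R)) {v : ℕ → ℂ}
    (hv : Set.InjOn v (Finset.range k)) (hvR : ∀ m ∈ Finset.range k, v m ∈ Metric.ball c R) :
    ∮ z in C(c, R), f z / ∏ s ∈ Finset.range k, (z - v s) =
      2 * Real.pi * Complex.I * ∑ m ∈ Finset.range k,
        f (v m) / ∏ s ∈ (Finset.range k).erase m, (v m - v s) := by
  have hne : ∀ z ∈ Metric.sphere c R, ∀ m ∈ Finset.range k, z ≠ v m := by
    rintro z hz m hm rfl
    exact absurd (Metric.mem_sphere.1 hz) (Metric.mem_ball.1 (hvR m hm)).ne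
  have hcongr : Set.EqOn (fun z => f z / ∏ s ∈ Finset.range k, (z - v s))
      (fun z => ∑ m ∈ Finset.range k,
        (Lagrange.nodalWeight (Finset.range k) v m) • ((z - v m)⁻¹ • f z)) (Metric.sphere c R) := by
    intro z hz
    have h := Lagrange.eval_interpolate_not_at_node (s := Finset.range k) (v := v) 1 (hne z hz)
    rw [Lagrange.interpolate_one hv ⟨0, Finset.mem_range.2 hk⟩, eval_one, Lagrange.eval_nodal] at h
    have hn : ∏ s ∈ Finset.range k, (z - v s) ≠ 0 :=
      Finset.prod_ne_zero_iff.2 fun s hs => sub_ne_zero.2 (hne z hz s hs)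
    simp only
    rw [div_eq_iff hn]
    calc f z = f z * ((∏ s ∈ Finset.range k, (z - v s)) * _) := by rw [← h, mul_one]
      _ = _ := by
        rw [Finset.sum_mul, Finset.mul_sum, Finset.mul_sum]
        refine Finset.sum_congr rfl fun m _ => ?_
        simp only [smul_eq_mul, Pi.one_apply]
        ring
  rw [circleIntegral.integral_congr hR.le hcongr, circleIntegral.integral_fun_sum]
  · rw [Finset.mul_sum]
    refine Finset.sum_congr rfl fun m hm => ?_
    rw [circleIntegral.integral_smul, hf.circleIntegral_sub_inv_smul (hvR m hm),
      Lagrange.nodalWeight_eq_eval_nodal_erase_inv, Lagrange.eval_nodal]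
    simp only [smul_eq_mul]
    ring
  · intro m hm
    refine ContinuousOn.circleIntegrable hR.le ?_
    have h1 : ContinuousOn (fun z => (z - v m)⁻¹) (Metric.sphere c R) :=
      ContinuousOn.inv₀ (by fun_prop) fun z hz => sub_ne_zero.2 (hne z hz m hm)
    exact (h1.smul (hf.continuousOn.mono Metric.sphere_subset_closedBall)).const_smul
      (Lagrange.nodalWeight (Finset.range k) v m)

theorem hasDerivAt_circleIntegral {F : ℂ → ℂ → ℂ} {c : ℂ} {R r : ℝ} (hR : 0 ≤ R)
    (hF : ∀ z ∈ Metric.sphere c R, ∀ ε ∈ Metric.ball (0 : ℂ) r,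
      AnalyticAt ℂ (Function.uncurry F) (z, ε)) {ε₀ : ℂ} (hε₀ : ε₀ ∈ Metric.ball (0 : ℂ) r) :
    HasDerivAt (fun ε => ∮ z in C(c, R), F z ε) (∮ z in C(c, R), deriv (F z) ε₀) ε₀ := by
  have hF' : AnalyticOnNhd ℂ (Function.uncurry F) (Metric.sphere c R ×ˢ Metric.ball (0 : ℂ) r) :=
    fun p hp => hF p.1 hp.1 p.2 hp.2
  have hder : ∀ z ∈ Metric.sphere c R, ∀ ε ∈ Metric.ball (0 : ℂ) r,
      HasDerivAt (F z) (fderiv ℂ (Function.uncurry F) (z, ε) (0, 1)) ε := by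
    intro z hz ε hε
    have h1 := (hF z hz ε hε).differentiableAt.hasFDerivAt
    have h2 : HasDerivAt (fun ε : ℂ => (z, ε)) (0, 1) ε :=
      (hasDerivAt_const ε z).prodMk (hasDerivAt_id ε)
    exact h1.comp_hasDerivAt ε h2
  have hcont : ContinuousOn (fun p : ℂ × ℂ => fderiv ℂ (Function.uncurry F) p (0, 1))
      (Metric.sphere c R ×ˢ Metric.ball (0 : ℂ) r) :=
    hF'.fderiv.continuousOn.clm_apply continuousOn_const
  -- A smaller closed ball makes the parameter set compact, so the ε-derivative has a uniform bound
  -- on circle times ball and dominates the difference quotients.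
  obtain ⟨r', hr', hsub⟩ := Metric.nhds_basis_closedBall.mem_iff.1 (Metric.isOpen_ball.mem_nhds hε₀)
  obtain ⟨B, hB⟩ := ((isCompact_sphere c R).prod
    (isCompact_closedBall ε₀ r')).exists_bound_of_continuousOn
      (hcont.mono (Set.prod_mono le_rfl hsub))
  have hmem : ∀ θ, circleMap c R θ ∈ Metric.sphere c R := fun θ => circleMap_mem_sphere c hR θ
  have hcF : ∀ ε ∈ Metric.ball (0 : ℂ) r,
      Continuous fun θ : ℝ => deriv (circleMap c R) θ • F (circleMap c R θ) ε := by
    intro ε hε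
    have h1 : Continuous fun θ : ℝ => F (circleMap c R θ) ε :=
      hF'.continuousOn.comp_continuous (f := fun θ : ℝ => (circleMap c R θ, ε))
        (by fun_prop) fun θ => ⟨hmem θ, hε⟩
    simp only [deriv_circleMap]
    exact ((continuous_circleMap 0 R).mul continuous_const).smul h1
  have key := intervalIntegral.hasDerivAt_integral_of_dominated_loc_of_deriv_le
    (μ := volume) (a := 0) (b := 2 * Real.pi) (𝕜 := ℂ)
    (F := fun ε θ => deriv (circleMap c R) θ • F (circleMap c R θ) ε)
    (F' := fun ε θ => deriv (circleMap c R) θ •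
      fderiv ℂ (Function.uncurry F) (circleMap c R θ, ε) (0, 1))
    (x₀ := ε₀) (s := Metric.closedBall ε₀ r') (bound := fun _ => R * B)
    (Metric.closedBall_mem_nhds _ hr')
    (by
      filter_upwards [Metric.isOpen_ball.mem_nhds hε₀] with ε hε
      exact (hcF ε hε).aestronglyMeasurable)
    ((hcF ε₀ hε₀).intervalIntegrable _ _)
    (by
      have h1 : Continuous fun θ : ℝ => fderiv ℂ (Function.uncurry F) (circleMap c R θ, ε₀) (0, 1) :=
        hcont.comp_continuous (f := fun θ : ℝ => (circleMap c R θ, ε₀))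
          (by fun_prop) fun θ => ⟨hmem θ, hε₀⟩
      simp only [deriv_circleMap]
      exact (((continuous_circleMap 0 R).mul continuous_const).smul h1).aestronglyMeasurable)
    (Eventually.of_forall fun θ _ ε hε => by
      rw [norm_smul]
      refine mul_le_mul (by simp [abs_of_nonneg hR]) (hB (_, ε) ⟨hmem θ, hε⟩) (norm_nonneg _) hR)
    (by simp)
    (Eventually.of_forall fun θ _ ε hε => (hder _ (hmem θ) ε (hsub hε)).fun_const_smul _)
  have h := key.2
  refine h.congr_deriv ?_
  rw [circleIntegral]
  refine intervalIntegral.integral_congr fun θ _ => ?_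
  rw [(hder _ (hmem θ) ε₀ hε₀).deriv]

/-- A sequence `S(1/n)`, with `S` analytic at `0`, has an asymptotic expansion. -/
theorem exists_hasAsymptoticExpansion {f : ℕ → ℝ} {S : ℂ → ℂ} (hS : AnalyticAt ℂ S 0)
    (hf : ∀ᶠ n : ℕ in atTop, (f n : ℂ) = S (n : ℂ)⁻¹) :
    ∃ c : ℕ → ℝ, HasAsymptoticExpansion f c ∧ c 0 = (S 0).re ∧ c 1 = (deriv S 0).re := by
  obtain ⟨p, hp⟩ := hS
  refine ⟨fun j => (p.coeff j).re, fun P => ?_, ?_, ?_⟩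
  · have hlim : Tendsto (fun n : ℕ => ((n : ℂ))⁻¹) atTop (nhds 0) :=
      tendsto_inv_atTop_nhds_zero_nat
    have h1 := (hp.isBigO_sub_partialSum_pow (P + 1)).comp_tendsto hlim
    have h2 : (fun n : ℕ => f n - ∑ j ∈ Finset.range (P + 1), (p.coeff j).re * (n : ℝ) ^ (-(j : ℤ)))
        =O[atTop] fun n : ℕ => (n : ℝ)⁻¹ ^ (P + 1) := by
      refine IsBigO.trans ?_ (h1.trans (IsBigO.of_bound 1 ?_))
      · refine IsBigO.of_bound 1 ?_
        filter_upwards [hf] with n hn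
        have : f n - ∑ j ∈ Finset.range (P + 1), (p.coeff j).re * (n : ℝ) ^ (-(j : ℤ)) =
            (S (0 + (n : ℂ)⁻¹) - p.partialSum (P + 1) (n : ℂ)⁻¹).re := by
          rw [zero_add, ← hn, FormalMultilinearSeries.partialSum, Complex.sub_re, Complex.ofReal_re,
            Complex.re_sum]
          congr 1
          refine Finset.sum_congr rfl fun j _ => ?_
          rw [FormalMultilinearSeries.apply_eq_pow_smul_coeff, smul_eq_mul, inv_pow,
            show ((n : ℂ) ^ j)⁻¹ = (((n : ℝ) ^ (-(j : ℤ)) : ℝ) : ℂ) by simp,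
            Complex.re_ofReal_mul, mul_comm]
        rw [this, one_mul]
        exact Complex.abs_re_le_norm _
      · exact Eventually.of_forall fun n => by simp
    refine h2.trans_isLittleO ?_
    have h3 : (fun n : ℕ => (n : ℝ) ^ (-(P : ℤ))) = fun n : ℕ => 1 * (n : ℝ)⁻¹ ^ P := by
      funext n
      simp
    rw [h3]
    simp only [pow_succ']
    refine IsLittleO.mul_isBigO ?_ (isBigO_refl _ _)
    exact (isLittleO_one_iff ℝ).2 tendsto_inv_atTop_nhds_zero_nat
  · simp only
    rw [← hp.coeff_zero 1]
    rfl
  · simp only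
    rw [hp.deriv]
    rfl

/-- Strong induction: once the earlier coefficients agree, the error estimate at order p forces the
defining limit to be c p. -/
theorem HasAsymptoticExpansion.asymptoticCoeff_eq {f : ℕ → ℝ} {c : ℕ → ℝ}
    (h : HasAsymptoticExpansion f c) : asymptoticCoeff f = c := by
  funext p
  induction p using Nat.strong_induction_on with
  | _ p ih =>
    rw [asymptoticCoeff]
    refine Tendsto.limUnder_eq ?_
    have hsum : ∀ n : ℕ, ∑ q : Fin p, asymptoticCoeff f q * (n : ℝ) ^ (-((q : ℕ) : ℤ)) =
        ∑ q ∈ Finset.range p, c q * (n : ℝ) ^ (-(q : ℤ)) := by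
      intro n
      rw [Finset.sum_range]
      exact Finset.sum_congr rfl fun q _ => by rw [ih q q.isLt]
    simp only [hsum]
    have h1 := (h p).tendsto_div_nhds_zero
    have h2 : Tendsto (fun n : ℕ => (f n - ∑ q ∈ Finset.range (p + 1), c q * (n : ℝ) ^ (-(q : ℤ))) /
        (n : ℝ) ^ (-(p : ℤ)) + c p) atTop (nhds (c p)) := by
      simpa using h1.add_const (c p)
    refine h2.congr' ?_
    filter_upwards [eventually_gt_atTop 0] with n hn
    have hn' : (n : ℝ) ^ p ≠ 0 := by positivity
    rw [Finset.sum_range_succ, zpow_neg, zpow_natCast]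
    field_simp
    ring

theorem hasAsymptoticExpansion_asymptoticCoeff {f : ℕ → ℝ} {S : ℂ → ℂ} (hS : AnalyticAt ℂ S 0)
    (hf : ∀ᶠ n : ℕ in atTop, (f n : ℂ) = S (n : ℂ)⁻¹) :
    HasAsymptoticExpansion f (asymptoticCoeff f) ∧ asymptoticCoeff f 0 = (S 0).re ∧
      asymptoticCoeff f 1 = (deriv S 0).re := by
  obtain ⟨c, hc, h0, h1⟩ := exists_hasAsymptoticExpansion hS hf
  rw [hc.asymptoticCoeff_eq]
  exact ⟨hc, h0, h1⟩

theorem hasDerivAt_prod_of_eq {k : ℕ} {G : ℕ → ℂ → ℂ} {q : ℂ} {d : ℕ → ℂ}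
    (hG0 : ∀ r, G r 0 = q) (hG : ∀ r, HasDerivAt (G r) (d r) 0) :
    HasDerivAt (fun ε => ∏ r ∈ Finset.range k, G r ε)
      (q ^ (k - 1) * ∑ r ∈ Finset.range k, d r) 0 := by
  have h := HasDerivAt.fun_finsetProd (u := Finset.range k) fun r _ => hG r
  refine h.congr_deriv ?_
  rw [Finset.mul_sum]
  refine Finset.sum_congr rfl fun r hr => ?_
  rw [Finset.prod_congr rfl fun j _ => hG0 j, Finset.prod_const, Finset.card_erase_of_mem hr,
    Finset.card_range, smul_eq_mul]

/-- If a family of contour integrals agrees with `f` at `1/n`, its Taylor coefficients give the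
asymptotic expansion of `f`. -/
theorem hasAsymptoticExpansion_of_circleIntegral {f : ℕ → ℝ} {F : ℂ → ℂ → ℂ} {c A : ℂ} {R r : ℝ}
    (hR : 0 ≤ R) (hr : 0 < r)
    (hF : ∀ z ∈ Metric.sphere c R, ∀ ε ∈ Metric.ball (0 : ℂ) r,
      AnalyticAt ℂ (Function.uncurry F) (z, ε))
    (hf : ∀ᶠ n : ℕ in atTop, (f n : ℂ) = A * ∮ z in C(c, R), F z (n : ℂ)⁻¹) :
    HasAsymptoticExpansion f (asymptoticCoeff f) ∧
      asymptoticCoeff f 0 = (A * ∮ z in C(c, R), F z 0).re ∧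
      asymptoticCoeff f 1 = (A * ∮ z in C(c, R), deriv (F z) 0).re := by
  have hder : ∀ ε ∈ Metric.ball (0 : ℂ) r, HasDerivAt (fun ε => A * ∮ z in C(c, R), F z ε)
      (A * ∮ z in C(c, R), deriv (F z) ε) ε := fun ε hε =>
    (hasDerivAt_circleIntegral hR hF hε).const_mul A
  have h0 : (0 : ℂ) ∈ Metric.ball (0 : ℂ) r := Metric.mem_ball_self hr
  have hS : AnalyticAt ℂ (fun ε => A * ∮ z in C(c, R), F z ε) 0 :=
    (DifferentiableOn.analyticAt (s := Metric.ball (0 : ℂ) r)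
      (fun ε hε => (hder ε hε).differentiableAt.differentiableWithinAt)
      (Metric.isOpen_ball.mem_nhds h0))
  have h := hasAsymptoticExpansion_asymptoticCoeff hS hf
  rwa [(hder 0 h0).deriv] at h

theorem sub_ne_zero_of_norm_lt {x y : ℂ} (h : ‖y‖ < ‖x‖) : x - y ≠ 0 := by
  intro h0
  rw [sub_eq_zero.1 h0] at h
  exact lt_irrefl _ h

theorem add_ne_zero_of_norm_lt {x y : ℂ} (h : ‖y‖ < ‖x‖) : x + y ≠ 0 := by
  rw [← sub_neg_eq_add]
  exact sub_ne_zero_of_norm_lt (by rwa [norm_neg])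

theorem norm_mul_lt_of_norm_lt_div {ε : ℂ} {x : ℂ} {R C : ℝ} (hC : 0 < C) (hε : ‖ε‖ < R / C)
    (hx : ‖x‖ ≤ C) : ‖ε * x‖ < R := by
  rw [norm_mul]
  calc ‖ε‖ * ‖x‖ ≤ ‖ε‖ * C := by gcongr
    _ < R := (lt_div_iff₀ hC).1 hε

theorem norm_natCast_add_one_le {r k : ℕ} (hr : r ∈ Finset.range k) : ‖(r : ℂ) + 1‖ ≤ k := by
  rw [← Nat.cast_succ, Complex.norm_natCast]
  exact_mod_cast Finset.mem_range.1 hr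

theorem norm_natCast_le {r k : ℕ} (hr : r ∈ Finset.range k) : ‖(r : ℂ)‖ ≤ k := by
  rw [Complex.norm_natCast]
  exact_mod_cast (Finset.mem_range.1 hr).le

theorem eventually_norm_inv_natCast_mem_ball {r : ℝ} (hr : 0 < r) :
    ∀ᶠ n : ℕ in atTop, (n : ℂ)⁻¹ ∈ Metric.ball (0 : ℂ) r := by
  have hlim : Tendsto (fun n : ℕ => ((n : ℂ))⁻¹) atTop (nhds 0) := tendsto_inv_atTop_nhds_zero_nat
  exact hlim.eventually (Metric.ball_mem_nhds 0 hr)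

/-! ### Delay times -/

def delayIntegrand (k : ℕ) (w : ℝ) (z ε : ℂ) : ℂ :=
  (∏ r ∈ Finset.range k, (z - 1 - ε * r) / (z + w - 1 - ε * r)) /
    ∏ r ∈ Finset.range k, (z - ε * r)

def delayKernel (w : ℝ) (z : ℂ) : ℂ := (z - 1) / ((z + w - 1) * z)

theorem hasDerivAt_delayKernel {w : ℝ} {z : ℂ} (h1 : z + w - 1 ≠ 0) (h2 : z ≠ 0) :
    HasDerivAt (delayKernel w)
      (((z + w - 1) * z - (z - 1) * (z + (z + w - 1))) / ((z + w - 1) * z) ^ 2) z := by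
  have hn : HasDerivAt (fun z : ℂ => z - 1) 1 z := (hasDerivAt_id z).sub_const 1
  have hd1 : HasDerivAt (fun z : ℂ => z + w - 1) 1 z := ((hasDerivAt_id z).add_const _).sub_const 1
  have hd : HasDerivAt (fun z : ℂ => (z + w - 1) * z) (1 * z + (z + w - 1) * 1) z :=
    hd1.mul (hasDerivAt_id z)
  refine (hn.div hd (mul_ne_zero h1 h2)).congr_deriv ?_
  ring

/-- Each factor, including its node denominator, is the kernel K evaluated at z - εr. Hence the
derivative at 0 is a constant times K^(k-1) K'. -/
theorem hasDerivAt_delayIntegrand {k : ℕ} {w : ℝ} {z : ℂ} (h1 : z + w - 1 ≠ 0) (h2 : z ≠ 0) :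
    HasDerivAt (delayIntegrand k w z) (delayKernel w z ^ (k - 1) * ∑ r ∈ Finset.range k,
      (-(r : ℂ)) * deriv (delayKernel w) z) 0 := by
  have hfun : delayIntegrand k w z = fun ε => ∏ r ∈ Finset.range k, delayKernel w (z - ε * r) := by
    funext ε
    rw [delayIntegrand, ← Finset.prod_div_distrib]
    refine Finset.prod_congr rfl fun r _ => ?_
    rw [delayKernel, div_div]
    congr 1 <;> ring
  rw [hfun]
  refine hasDerivAt_prod_of_eq (fun r => by simp) fun r => ?_
  have hin : HasDerivAt (fun ε : ℂ => z - ε * r) (-(r : ℂ)) 0 := by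
    simpa using ((hasDerivAt_id (0 : ℂ)).mul_const (r : ℂ)).const_sub z
  have hout : HasDerivAt (delayKernel w) (deriv (delayKernel w) z) (z - 0 * r) := by
    rw [zero_mul, sub_zero]
    exact (hasDerivAt_delayKernel h1 h2).differentiableAt.hasDerivAt
  exact (hout.comp 0 hin).congr_deriv (mul_comm _ _)

theorem delay_expansion {k : ℕ} {w : ℝ} (hk : 0 < k) (hw : 1 < w) :
    HasAsymptoticExpansion (delaySeq 2 k w) (fun p => delayCoeff 2 k p w) ∧
      delayCoeff 2 k 1 w = 0 := by
  -- The pole 1 - w lies at distance 2R from 0. For |ε| < R/k the nodes stay inside the circle and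
  -- the shifted poles stay outside.
  set R : ℝ := (w - 1) / 2 with hRdef
  have hR : 0 < R := by rw [hRdef]; linarith
  have hkpos : (0 : ℝ) < k := by exact_mod_cast hk
  have hden : ∀ z ∈ Metric.closedBall (0 : ℂ) R, ∀ ε ∈ Metric.ball (0 : ℂ) (R / k),
      ∀ r ∈ Finset.range k, z + w - 1 - ε * r ≠ 0 := by
    intro z hz ε hε r hr
    rw [mem_closedBall_zero_iff] at hz
    rw [mem_ball_zero_iff] at hε
    have h1 := norm_mul_lt_of_norm_lt_div hkpos hε (norm_natCast_le hr)
    have h2 : ‖((w - 1 : ℝ) : ℂ)‖ = 2 * R := by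
      rw [Complex.norm_real, Real.norm_of_nonneg (by linarith), hRdef]
      ring
    have h3 : ‖((w - 1 : ℝ) : ℂ)‖ ≤ ‖z + w - 1‖ + ‖z‖ := by
      refine (norm_sub_le (z + w - 1) z).trans_eq' ?_
      push_cast
      congr 1
      ring
    exact sub_ne_zero_of_norm_lt (by linarith)
  have hnode : ∀ z ∈ Metric.sphere (0 : ℂ) R, ∀ ε ∈ Metric.ball (0 : ℂ) (R / k),
      ∀ r ∈ Finset.range k, z - ε * r ≠ 0 := by
    intro z hz ε hε r hr
    rw [mem_sphere_zero_iff_norm] at hz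
    rw [mem_ball_zero_iff] at hε
    exact sub_ne_zero_of_norm_lt (by
      rw [hz]; exact norm_mul_lt_of_norm_lt_div hkpos hε (norm_natCast_le hr))
  have hmem : ∀ z ∈ Metric.sphere (0 : ℂ) R, z + w - 1 ≠ 0 ∧ z ≠ 0 := by
    intro z hz
    have h0 : (0 : ℂ) ∈ Metric.ball (0 : ℂ) (R / k) := Metric.mem_ball_self (by positivity)
    have hr : 0 ∈ Finset.range k := Finset.mem_range.2 hk
    exact ⟨by simpa using hden z (Metric.sphere_subset_closedBall hz) 0 h0 0 hr,
      by simpa using hnode z hz 0 h0 0 hr⟩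
  have hF : ∀ z ∈ Metric.sphere (0 : ℂ) R, ∀ ε ∈ Metric.ball (0 : ℂ) (R / k),
      AnalyticAt ℂ (Function.uncurry (delayIntegrand k w)) (z, ε) := by
    intro z hz ε hε
    have a1 : AnalyticAt ℂ (fun p : ℂ × ℂ => p.1) (z, ε) := analyticAt_fst
    have a2 : AnalyticAt ℂ (fun p : ℂ × ℂ => p.2) (z, ε) := analyticAt_snd
    refine AnalyticAt.div (f := fun p : ℂ × ℂ => ∏ r ∈ Finset.range k,
        (p.1 - 1 - p.2 * r) / (p.1 + w - 1 - p.2 * r))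
      (g := fun p : ℂ × ℂ => ∏ r ∈ Finset.range k, (p.1 - p.2 * r))
      (Finset.analyticAt_fun_prod _ fun r hr => AnalyticAt.fun_div (by fun_prop) (by fun_prop)
        (hden z (Metric.sphere_subset_closedBall hz) ε hε r hr))
      (Finset.analyticAt_fun_prod _ fun r _ => by fun_prop) ?_
    exact Finset.prod_ne_zero_iff.2 fun r hr => hnode z hz ε hε r hr
  have hf : ∀ᶠ n : ℕ in atTop, (delaySeq 2 k w n : ℂ) =
      -1 / k * (2 * Real.pi * Complex.I)⁻¹ *
        ∮ z in C(0, R), delayIntegrand k w z (n : ℂ)⁻¹ := by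
    have hlarge : ∀ᶠ n : ℕ in atTop, (k : ℝ) < n * (w - 1) + 1 := by
      have : Tendsto (fun n : ℕ => (n : ℝ) * (w - 1) + 1) atTop atTop :=
        tendsto_atTop_add_const_right _ _
          (tendsto_natCast_atTop_atTop.atTop_mul_const (by linarith))
      exact this.eventually_gt_atTop _
    filter_upwards [eventually_ge_atTop k, hlarge,
      eventually_norm_inv_natCast_mem_ball (show 0 < R / k by positivity)] with n hkn hlg hε
    have hn : (n : ℂ)⁻¹ ≠ 0 := inv_ne_zero (Nat.cast_ne_zero.2 (by omega))
    have hres := circleIntegral_div_prod_sub (c := 0) hR hk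
      (f := fun z => ∏ r ∈ Finset.range k, (z - 1 - (n : ℂ)⁻¹ * r) / (z + w - 1 - (n : ℂ)⁻¹ * r))
      (v := fun r => (n : ℂ)⁻¹ * r)
      (DifferentiableOn.fun_finsetProd fun r hr => DifferentiableOn.fun_div (by fun_prop)
        (by fun_prop) fun z hz => hden z hz _ hε r hr)
      (fun r _ s _ h => Nat.cast_injective (mul_left_cancel₀ hn h))
      (fun r hr => by
        rw [mem_ball_zero_iff] at hε ⊢
        exact norm_mul_lt_of_norm_lt_div hkpos hε (norm_natCast_le hr))
    have hpi : (2 * Real.pi * Complex.I : ℂ) ≠ 0 := Complex.two_pi_I_ne_zero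
    rw [delaySeq_eq hk hkn hlg]
    simp only [delayIntegrand]
    rw [hres, mul_assoc, inv_mul_cancel_left₀ hpi]
    push_cast
    rfl
  obtain ⟨e1, -, e3⟩ := hasAsymptoticExpansion_of_circleIntegral hR.le (by positivity) hF hf
  refine ⟨e1, ?_⟩
  rw [delayCoeff, e3]
  -- The first-order integrand has a primitive proportional to K^k along the circle.
  have hzero : ∮ z in C(0, R), deriv (delayIntegrand k w z) 0 = 0 := by
    refine circleIntegral.integral_eq_zero_of_hasDerivWithinAt hR.le
      (f := fun z => (∑ r ∈ Finset.range k, -(r : ℂ)) / k * delayKernel w z ^ k) fun z hz => ?_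
    obtain ⟨h1, h2⟩ := hmem z hz
    have hK := (hasDerivAt_delayKernel h1 h2).differentiableAt.hasDerivAt
    refine HasDerivAt.hasDerivWithinAt (((hK.fun_pow k).const_mul _).congr_deriv ?_)
    rw [(hasDerivAt_delayIntegrand h1 h2).deriv, ← Finset.sum_mul]
    have : (k : ℂ) ≠ 0 := Nat.cast_ne_zero.2 hk.ne'
    field_simp
  rw [hzero, mul_zero, Complex.zero_re]

/-! ### Transmission eigenvalues -/

def transmissionIntegrand (k : ℕ) (u a : ℝ) (z ε : ℂ) : ℂ :=
  (∏ r ∈ Finset.range k,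
      (z + u - 1 + ε * (r + 1)) * (z + ε * (r + 1)) / (z + u + ε * (a + (r + 1)))) /
    ∏ r ∈ Finset.range k, (z - (1 - ε * (r + 1)))

def transmissionKernel (u : ℝ) (z : ℂ) : ℂ := (z + u - 1) * z / ((z + u) * (z - 1))

theorem hasDerivAt_transmissionKernel {u : ℝ} {z : ℂ} (h1 : z + u ≠ 0) (h2 : z - 1 ≠ 0) :
    HasDerivAt (transmissionKernel u)
      (((z + (z + u - 1)) * ((z + u) * (z - 1)) - (z + u - 1) * z * (z - 1 + (z + u))) /
        ((z + u) * (z - 1)) ^ 2) z := by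
  have hn1 : HasDerivAt (fun z : ℂ => z + u - 1) 1 z := ((hasDerivAt_id z).add_const _).sub_const 1
  have hd1 : HasDerivAt (fun z : ℂ => z + u) 1 z := (hasDerivAt_id z).add_const _
  have hd2 : HasDerivAt (fun z : ℂ => z - 1) 1 z := (hasDerivAt_id z).sub_const 1
  refine ((hn1.mul (hasDerivAt_id z)).div (hd1.mul hd2) (mul_ne_zero h1 h2)).congr_deriv ?_
  simp only [id, Pi.mul_apply]
  ring

/-- Without a, each factor would be K(z + ε(r+1)); the parameter a perturbs only the factor z + u of
the denominator and contributes -a K/(z+u). -/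
theorem hasDerivAt_transmissionIntegrand {k : ℕ} {u a : ℝ} {z : ℂ} (h1 : z + u ≠ 0)
    (h2 : z - 1 ≠ 0) :
    HasDerivAt (transmissionIntegrand k u a z)
      (transmissionKernel u z ^ (k - 1) * ∑ r ∈ Finset.range k,
        (((r : ℂ) + 1) * deriv (transmissionKernel u) z - a * transmissionKernel u z / (z + u)))
      0 := by
  have hfun : transmissionIntegrand k u a z = fun ε => ∏ r ∈ Finset.range k,
      ((z + u - 1 + ε * (r + 1)) * (z + ε * (r + 1)) /
        ((z + u + ε * (a + (r + 1))) * (z - 1 + ε * (r + 1)))) := by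
    funext ε
    rw [transmissionIntegrand, ← Finset.prod_div_distrib]
    refine Finset.prod_congr rfl fun r _ => ?_
    rw [div_div]
    congr 2
    ring
  rw [hfun]
  refine hasDerivAt_prod_of_eq (fun r => by simp [transmissionKernel]) fun r => ?_
  have hlin : ∀ x c : ℂ, HasDerivAt (fun ε : ℂ => x + ε * c) c 0 := fun x c => by
    simpa using ((hasDerivAt_id (0 : ℂ)).mul_const c).const_add x
  have h := ((hlin (z + u - 1) (r + 1)).mul (hlin z (r + 1))).div
    ((hlin (z + u) (a + (r + 1))).mul (hlin (z - 1) (r + 1)))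
    (by simpa using ⟨h1, h2⟩)
  refine h.congr_deriv ?_
  rw [(hasDerivAt_transmissionKernel h1 h2).deriv, transmissionKernel]
  simp only [Pi.mul_apply, zero_mul, add_zero]
  field_simp
  ring

theorem norm_le_norm_add_of_mem_closedBall {u : ℝ} (hu : 0 < u) {z : ℂ}
    (hz : z ∈ Metric.closedBall (1 : ℂ) 1) : u ≤ ‖z + u‖ := by
  rw [Metric.mem_closedBall, dist_eq_norm] at hz
  have h2 : ‖((1 + u : ℝ) : ℂ)‖ = 1 + u := by
    rw [Complex.norm_real, Real.norm_of_nonneg (by linarith)]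
  have h3 : ‖((1 + u : ℝ) : ℂ)‖ ≤ ‖z + u‖ + ‖z - 1‖ := by
    refine (norm_sub_le (z + u) (z - 1)).trans_eq' ?_
    push_cast
    congr 1
    ring
  linarith

theorem transmission_expansion {k : ℕ} {u δ : ℝ} (hk : 0 < k) (hu : 1 < u) (hδ : -2 < δ)
    (hδ' : δ ≤ 2) :
    HasAsymptoticExpansion (transmissionSeq 2 δ k u) (fun p => transmissionCoeff 2 δ k p u) ∧
      transmissionCoeff 2 δ k 0 u = (1 / k * (2 * Real.pi * Complex.I)⁻¹ *
        ∮ z in C(1, 1), transmissionKernel u z ^ k).re ∧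
      transmissionCoeff 2 δ k 1 u = (-(δ / 2) * (2 * Real.pi * Complex.I)⁻¹ *
        ∮ z in C(1, 1), transmissionKernel u z ^ k / (z + u)).re := by
  have hkpos : (0 : ℝ) < k + 1 := by positivity
  have hk0 : (k : ℂ) ≠ 0 := Nat.cast_ne_zero.2 hk.ne'
  -- On the disc |z + u| ≥ u > 1, while |δ/2| ≤ 1 and r + 1 ≤ k bound the perturbation by |ε|(k+1) <
  -- 1.
  have hden : ∀ z ∈ Metric.closedBall (1 : ℂ) 1, ∀ ε ∈ Metric.ball (0 : ℂ) (1 / (k + 1)),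
      ∀ r ∈ Finset.range k, z + u + ε * ((δ / 2 : ℝ) + (r + 1)) ≠ 0 := by
    intro z hz ε hε r hr
    rw [mem_ball_zero_iff] at hε
    refine add_ne_zero_of_norm_lt ((norm_mul_lt_of_norm_lt_div hkpos hε ?_).trans
      (hu.trans_le (norm_le_norm_add_of_mem_closedBall (by linarith) hz)))
    refine (norm_add_le _ _).trans ?_
    have h1 : ‖((δ / 2 : ℝ) : ℂ)‖ ≤ 1 := by
      rw [Complex.norm_real, Real.norm_eq_abs, abs_le]
      constructor <;> linarith
    linarith [norm_natCast_add_one_le hr]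
  have hnodemem : ∀ ε ∈ Metric.ball (0 : ℂ) (1 / (k + 1)), ∀ r ∈ Finset.range k,
      ‖ε * (r + 1)‖ < 1 := by
    intro ε hε r hr
    rw [mem_ball_zero_iff] at hε
    exact norm_mul_lt_of_norm_lt_div hkpos hε (by linarith [norm_natCast_add_one_le hr])
  have hnode : ∀ z ∈ Metric.sphere (1 : ℂ) 1, ∀ ε ∈ Metric.ball (0 : ℂ) (1 / (k + 1)),
      ∀ r ∈ Finset.range k, z - (1 - ε * (r + 1)) ≠ 0 := by
    intro z hz ε hε r hr
    rw [mem_sphere_iff_norm] at hz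
    rw [← sub_add]
    exact add_ne_zero_of_norm_lt (by rw [hz]; exact hnodemem ε hε r hr)
  have hmem : ∀ z ∈ Metric.sphere (1 : ℂ) 1, z + u ≠ 0 ∧ z - 1 ≠ 0 := by
    intro z hz
    have h1 := norm_le_norm_add_of_mem_closedBall (by linarith : 0 < u)
      (Metric.sphere_subset_closedBall hz)
    rw [mem_sphere_iff_norm] at hz
    exact ⟨norm_pos_iff.1 (by linarith), norm_pos_iff.1 (by rw [hz]; exact one_pos)⟩
  have hF : ∀ z ∈ Metric.sphere (1 : ℂ) 1, ∀ ε ∈ Metric.ball (0 : ℂ) (1 / (k + 1)),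
      AnalyticAt ℂ (Function.uncurry (transmissionIntegrand k u (δ / 2))) (z, ε) := by
    intro z hz ε hε
    have a1 : AnalyticAt ℂ (fun p : ℂ × ℂ => p.1) (z, ε) := analyticAt_fst
    have a2 : AnalyticAt ℂ (fun p : ℂ × ℂ => p.2) (z, ε) := analyticAt_snd
    refine AnalyticAt.div (f := fun p : ℂ × ℂ => ∏ r ∈ Finset.range k,
        (p.1 + u - 1 + p.2 * (r + 1)) * (p.1 + p.2 * (r + 1)) /
          (p.1 + u + p.2 * ((δ / 2 : ℝ) + (r + 1))))
      (g := fun p : ℂ × ℂ => ∏ r ∈ Finset.range k, (p.1 - (1 - p.2 * (r + 1))))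
      (Finset.analyticAt_fun_prod _ fun r hr => AnalyticAt.fun_div (by fun_prop) (by fun_prop)
        (hden z (Metric.sphere_subset_closedBall hz) ε hε r hr))
      (Finset.analyticAt_fun_prod _ fun r _ => by fun_prop) ?_
    exact Finset.prod_ne_zero_iff.2 fun r hr => hnode z hz ε hε r hr
  have hf : ∀ᶠ n : ℕ in atTop, (transmissionSeq 2 δ k u n : ℂ) =
      1 / k * (2 * Real.pi * Complex.I)⁻¹ *
        ∮ z in C(1, 1), transmissionIntegrand k u (δ / 2) z (n : ℂ)⁻¹ := by
    filter_upwards [eventually_ge_atTop k,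
      eventually_norm_inv_natCast_mem_ball (one_div_pos.2 hkpos)] with n hkn hε
    have hn : (n : ℂ)⁻¹ ≠ 0 := inv_ne_zero (Nat.cast_ne_zero.2 (by omega))
    have hres := circleIntegral_div_prod_sub (c := 1) one_pos hk
      (f := fun z => ∏ r ∈ Finset.range k, (z + u - 1 + (n : ℂ)⁻¹ * (r + 1)) *
        (z + (n : ℂ)⁻¹ * (r + 1)) / (z + u + (n : ℂ)⁻¹ * ((δ / 2 : ℝ) + (r + 1))))
      (v := fun r => 1 - (n : ℂ)⁻¹ * (r + 1))
      (DifferentiableOn.fun_finsetProd fun r hr => DifferentiableOn.fun_div (by fun_prop)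
        (by fun_prop) fun z hz => hden z hz _ hε r hr)
      (fun r _ s _ h => by
        have h' := mul_left_cancel₀ hn (sub_right_injective h)
        exact Nat.cast_injective (add_right_cancel h'))
      (fun r hr => by
        rw [mem_ball_iff_norm, sub_sub_cancel_left, norm_neg]
        exact hnodemem _ hε r hr)
    have hpi : (2 * Real.pi * Complex.I : ℂ) ≠ 0 := Complex.two_pi_I_ne_zero
    rw [transmissionSeq_eq hk hkn hu hδ]
    simp only [transmissionIntegrand]
    rw [hres, mul_assoc, inv_mul_cancel_left₀ hpi]
    push_cast
    rfl
  obtain ⟨e1, e2, e3⟩ := hasAsymptoticExpansion_of_circleIntegral zero_le_one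
    (one_div_pos.2 hkpos) hF hf
  refine ⟨e1, ?_, ?_⟩
  · rw [transmissionCoeff, e2]
    congr 2
    refine circleIntegral.integral_congr zero_le_one fun z _ => ?_
    simp only [transmissionIntegrand, zero_mul, add_zero, sub_zero, Finset.prod_const,
      Finset.card_range, transmissionKernel]
    rw [← div_pow, div_div]
  · rw [transmissionCoeff, e3]
    have hcongr : Set.EqOn (fun z => deriv (transmissionIntegrand k u (δ / 2) z) 0)
        (fun z => (∑ r ∈ Finset.range k, ((r : ℂ) + 1)) *
            (transmissionKernel u z ^ (k - 1) * deriv (transmissionKernel u) z) -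
          k * (δ / 2) * (transmissionKernel u z ^ k / (z + u))) (Metric.sphere 1 1) := by
      intro z hz
      obtain ⟨h1, h2⟩ := hmem z hz
      simp only
      rw [(hasDerivAt_transmissionIntegrand h1 h2).deriv, Finset.sum_sub_distrib, ← Finset.sum_mul,
        Finset.sum_const, Finset.card_range, nsmul_eq_mul, ← pow_sub_one_mul hk.ne']
      push_cast
      ring
    -- The exact part integrates to zero, so the first correction is proportional to δ.
    have hzero : ∮ z in C(1, 1), (∑ r ∈ Finset.range k, ((r : ℂ) + 1)) *
        (transmissionKernel u z ^ (k - 1) * deriv (transmissionKernel u) z) = 0 := by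
      refine circleIntegral.integral_eq_zero_of_hasDerivWithinAt zero_le_one
        (f := fun z => (∑ r ∈ Finset.range k, ((r : ℂ) + 1)) / k * transmissionKernel u z ^ k)
        fun z hz => ?_
      obtain ⟨h1, h2⟩ := hmem z hz
      have hK := (hasDerivAt_transmissionKernel h1 h2).differentiableAt.hasDerivAt
      refine HasDerivAt.hasDerivWithinAt (((hK.fun_pow k).const_mul _).congr_deriv ?_)
      field_simp
    have hKc : ContinuousOn (transmissionKernel u) (Metric.sphere 1 1) := fun z hz =>
      (hasDerivAt_transmissionKernel (hmem z hz).1 (hmem z hz).2).continuousAt.continuousWithinAt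
    have hK'c : ContinuousOn (deriv (transmissionKernel u)) (Metric.sphere 1 1) := by
      refine ContinuousOn.congr ?_ fun z hz =>
        (hasDerivAt_transmissionKernel (hmem z hz).1 (hmem z hz).2).deriv
      refine ContinuousOn.div (by fun_prop) (by fun_prop) fun z hz => ?_
      exact pow_ne_zero _ (mul_ne_zero (hmem z hz).1 (hmem z hz).2)
    rw [circleIntegral.integral_congr zero_le_one hcongr, circleIntegral.integral_sub, hzero,
      circleIntegral.integral_const_mul]
    · congr 1
      field_simp
      ring
    · exact ContinuousOn.circleIntegrable zero_le_one (by fun_prop)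
    · refine ContinuousOn.circleIntegrable zero_le_one ?_
      exact continuousOn_const.mul ((hKc.pow k).div (by fun_prop) fun z hz => (hmem z hz).1)

/-! ### Binomial sums -/

def centralSum (k : ℕ) (u : ℝ) : ℝ :=
  ∑ i ∈ Finset.range (k + 1), (k.choose i : ℝ) ^ 2 * u ^ (2 * i)

def narayanaSum (k : ℕ) (u : ℝ) : ℝ :=
  ∑ i ∈ Finset.range (k + 1), (k.choose i : ℝ) * k.choose (i + 1) * u ^ (2 * i + 1)

theorem centralSum_neg (k : ℕ) (u : ℝ) : centralSum k (-u) = centralSum k u := by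
  simp [centralSum, pow_mul]

theorem narayanaSum_neg (k : ℕ) (u : ℝ) : narayanaSum k (-u) = -narayanaSum k u := by
  simp [narayanaSum, pow_mul, pow_succ]

theorem centralSum_succ (k : ℕ) (u : ℝ) :
    centralSum (k + 1) u = (1 + u ^ 2) * centralSum k u + 2 * u * narayanaSum k u := by
  have h1 : centralSum k u =
      ∑ i ∈ Finset.range (k + 1), (k.choose (i + 1) : ℝ) ^ 2 * u ^ (2 * (i + 1)) + 1 := by
    have h := Finset.sum_range_succ (fun i => (k.choose i : ℝ) ^ 2 * u ^ (2 * i)) (k + 1)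
    rw [Nat.choose_succ_self, Finset.sum_range_succ'] at h
    rw [centralSum]
    simpa using h.symm
  rw [add_mul, one_mul]
  nth_rewrite 1 [h1]
  simp only [centralSum, narayanaSum]
  rw [Finset.sum_range_succ' _ (k + 1), Finset.mul_sum, Finset.mul_sum,
    add_right_comm _ (1 : ℝ), ← Finset.sum_add_distrib, add_right_comm _ (1 : ℝ),
    ← Finset.sum_add_distrib]
  congr 1
  · refine Finset.sum_congr rfl fun i _ => ?_
    rw [Nat.choose_succ_succ' k i]
    push_cast
    ring
  · simp

/-- The two absorption identities express (k+1) C(k,i+1) through C(k+1,i+2) with weight i+2 and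
through C(k+1,i+1) with weight k-i; the weights add up to k+2. -/
theorem choose_mul_choose_succ {k i : ℕ} (hi : i < k + 1) :
    ((k : ℝ) + 2) * ((k + 1).choose (i + 1) * (k + 1).choose (i + 2)) =
      (k + 1) * (k.choose (i + 1) * k.choose (i + 2) + k.choose i * k.choose (i + 1) +
        2 * k.choose (i + 1) ^ 2) := by
  have e1 : ((k : ℝ) + 1) * k.choose (i + 1) = (k + 1).choose (i + 2) * (i + 2) := by
    exact_mod_cast Nat.add_one_mul_choose_eq k (i + 1)
  have e2 : (k.choose (i + 1) : ℝ) * (k + 1) = (k + 1).choose (i + 1) * (k - i) := by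
    have h := Nat.choose_mul_succ_eq k (i + 1)
    rw [Nat.add_sub_add_right] at h
    have h' := congrArg (Nat.cast (R := ℝ)) h
    rw [Nat.cast_mul, Nat.cast_mul, Nat.cast_sub (by omega)] at h'
    exact_mod_cast h'
  have e3 : ((k + 1).choose (i + 1) : ℝ) = k.choose i + k.choose (i + 1) := by
    exact_mod_cast Nat.choose_succ_succ' k i
  have e4 : ((k + 1).choose (i + 2) : ℝ) = k.choose (i + 1) + k.choose (i + 2) := by
    exact_mod_cast Nat.choose_succ_succ' k (i + 1)
  have e5 : (k.choose (i + 1) * k.choose (i + 2) + k.choose i * k.choose (i + 1) +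
      2 * k.choose (i + 1) ^ 2 : ℝ) =
        k.choose (i + 1) * ((k + 1).choose (i + 1) + (k + 1).choose (i + 2)) := by
    rw [e3, e4]
    ring
  rw [e5]
  linear_combination (-((k + 1).choose (i + 1) : ℝ)) * e1 - ((k + 1).choose (i + 2) : ℝ) * e2

theorem narayanaSum_succ (k : ℕ) (u : ℝ) :
    (k + 2) * narayanaSum (k + 1) u =
      (k + 1) * ((1 + u ^ 2) * narayanaSum k u + 2 * u * centralSum k u) := by
  have h1 : narayanaSum k u = ∑ i ∈ Finset.range (k + 1),
      (k.choose (i + 1) : ℝ) * k.choose (i + 2) * u ^ (2 * (i + 1) + 1) + k * u := by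
    have h := Finset.sum_range_succ
      (fun i => (k.choose i : ℝ) * k.choose (i + 1) * u ^ (2 * i + 1)) (k + 1)
    rw [Nat.choose_succ_self, Finset.sum_range_succ'] at h
    rw [narayanaSum]
    simpa using h.symm
  have h2 : centralSum k u =
      ∑ i ∈ Finset.range (k + 1), (k.choose (i + 1) : ℝ) ^ 2 * u ^ (2 * (i + 1)) + 1 := by
    have h := Finset.sum_range_succ (fun i => (k.choose i : ℝ) ^ 2 * u ^ (2 * i)) (k + 1)
    rw [Nat.choose_succ_self, Finset.sum_range_succ'] at h
    rw [centralSum]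
    simpa using h.symm
  have h3 : ((k : ℝ) + 2) * ∑ i ∈ Finset.range (k + 1),
      ((k + 1).choose (i + 1) : ℝ) * (k + 1).choose (i + 2) * u ^ (2 * (i + 1) + 1) =
      (k + 1) * (∑ i ∈ Finset.range (k + 1),
          (k.choose (i + 1) : ℝ) * k.choose (i + 2) * u ^ (2 * (i + 1) + 1) +
        u ^ 2 * narayanaSum k u + 2 * u * ∑ i ∈ Finset.range (k + 1),
          (k.choose (i + 1) : ℝ) ^ 2 * u ^ (2 * (i + 1))) := by
    rw [narayanaSum, Finset.mul_sum, Finset.mul_sum, Finset.mul_sum, ← Finset.sum_add_distrib,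
      ← Finset.sum_add_distrib, Finset.mul_sum]
    refine Finset.sum_congr rfl fun i hi => ?_
    linear_combination u ^ (2 * (i + 1) + 1) * choose_mul_choose_succ (Finset.mem_range.1 hi)
  have h4 : narayanaSum (k + 1) u = ∑ i ∈ Finset.range (k + 1),
      ((k + 1).choose (i + 1) : ℝ) * (k + 1).choose (i + 2) * u ^ (2 * (i + 1) + 1) +
        (k + 1) * u := by
    rw [narayanaSum, Finset.sum_range_succ']
    simp
  rw [h4]
  linear_combination h3 - (k + 1 : ℝ) * h1 - 2 * u * (k + 1 : ℝ) * h2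

/-- The recurrences give (u+1)²(A_k + B_k) = A_{k+1} + B_{k+1} + B_{k+1}/(k+1), and the last term is
exactly what the next j subtracts in the explicit sum. Only u ≠ -1 is required, so the formula can
also be used at -u. -/
theorem transmissionLeading_succ {u : ℝ} (hu : u + 1 ≠ 0) (k : ℕ) :
    transmissionLeading (k + 1) u =
      u * (centralSum k u + narayanaSum k u) / (u + 1) ^ (2 * k + 1) := by
  induction k with
  | zero => simp [transmissionLeading, centralSum, narayanaSum]
  | succ k ih =>
    have hstep : transmissionLeading (k + 1 + 1) u = transmissionLeading (k + 1) u -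
        u * narayanaSum (k + 1) u / ((k + 1) * (u + 1) ^ (2 * k + 3)) := by
      rw [transmissionLeading, transmissionLeading, Finset.sum_Ico_succ_top (by omega), sub_sub]
      congr 2
      have hsum : ∑ i ∈ Finset.Icc 1 (k + 1), ((k + 1).choose i : ℝ) * ((k + 1).choose (i - 1) : ℝ) *
          (u ^ (2 * i) / (u + 1) ^ (2 * (k + 1) + 1)) =
          u * narayanaSum (k + 1) u / (u + 1) ^ (2 * k + 3) := by
        rw [narayanaSum, Finset.sum_range_succ, Nat.choose_succ_self, Nat.cast_zero, mul_zero,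
          zero_mul, add_zero, ← Finset.Ico_add_one_right_eq_Icc, Finset.sum_Ico_eq_sum_range,
          Finset.mul_sum, Finset.sum_div]
        refine Finset.sum_congr rfl fun i _ => ?_
        rw [Nat.add_sub_cancel_left, add_comm 1 i]
        ring
      rw [hsum]
      push_cast
      field_simp
    have hk : (k : ℝ) + 1 ≠ 0 := by positivity
    have hA := centralSum_succ k u
    have hB := narayanaSum_succ k u
    rw [hstep, ih, hA]
    rw [div_sub_div _ _ (pow_ne_zero _ hu) (mul_ne_zero hk (pow_ne_zero _ hu)),
      div_eq_div_iff (mul_ne_zero (pow_ne_zero _ hu) (mul_ne_zero hk (pow_ne_zero _ hu)))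
        (pow_ne_zero _ hu)]
    have e : (u + 1) ^ (2 * k + 3) = (u + 1) ^ (2 * k + 1) * (u + 1) ^ 2 := by ring
    have e' : (u + 1) ^ (2 * (k + 1) + 1) = (u + 1) ^ (2 * k + 1) * (u + 1) ^ 2 := by ring
    rw [e, e']
    generalize (u + 1) ^ (2 * k + 1) = p
    linear_combination (-u * p ^ 2 * (u + 1) ^ 2) * hB

/-! ### Residues -/

/-- This Möbius coordinate t sends the zero 1 and the pole -u to 0 and ∞ and makes K symmetric under
t ↦ 1/t. -/
def transmissionCoord (u : ℝ) (z : ℂ) : ℂ := (z - 1) / (z + u)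

theorem ne_zero_of_mem_sphere {u : ℝ} (hu : 0 < u) {z : ℂ} (hz : z ∈ Metric.sphere (1 : ℂ) 1) :
    z + u ≠ 0 ∧ z - 1 ≠ 0 := by
  have h1 := norm_le_norm_add_of_mem_closedBall hu (Metric.sphere_subset_closedBall hz)
  rw [mem_sphere_iff_norm] at hz
  exact ⟨norm_pos_iff.1 (by linarith), norm_pos_iff.1 (by rw [hz]; exact one_pos)⟩

theorem hasDerivAt_transmissionCoord {u : ℝ} {z : ℂ} (h1 : z + u ≠ 0) :
    HasDerivAt (transmissionCoord u) ((1 + u) / (z + u) ^ 2) z := by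
  have hd1 : HasDerivAt (fun z : ℂ => z + u) 1 z := (hasDerivAt_id z).add_const _
  have hd2 : HasDerivAt (fun z : ℂ => z - 1) 1 z := (hasDerivAt_id z).sub_const 1
  refine (hd2.div hd1 h1).congr_deriv ?_
  congr 1
  ring

/-- The weight (1+u)/(z+u)² is dt/dz, so this is ∮ t^m dt: t^m has a primitive unless m = -1, and
then the only enclosed pole is z = 1. -/
theorem circleIntegral_transmissionCoord_zpow {u : ℝ} (hu : 0 < u) (m : ℤ) :
    ∮ z in C(1, 1), transmissionCoord u z ^ m * ((1 + u) / (z + u) ^ 2) =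
      if m = -1 then 2 * Real.pi * Complex.I else 0 := by
  split_ifs with hm
  · have hcongr : Set.EqOn (fun z : ℂ => transmissionCoord u z ^ m * ((1 + u) / (z + u) ^ 2))
        (fun z => (z - 1)⁻¹ - (z + u)⁻¹) (Metric.sphere 1 1) := by
      intro z hz
      obtain ⟨h1, h2⟩ := ne_zero_of_mem_sphere hu hz
      simp only [hm, zpow_neg_one, transmissionCoord]
      field_simp
      ring
    have hne : ∀ z ∈ Metric.closedBall (1 : ℂ) 1, z + u ≠ 0 := fun z hz =>
      norm_pos_iff.1 (hu.trans_le (norm_le_norm_add_of_mem_closedBall hu hz))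
    have hd : DifferentiableOn ℂ (fun z : ℂ => (z + u)⁻¹) (Metric.closedBall 1 1) :=
      DifferentiableOn.fun_inv (by fun_prop) hne
    rw [circleIntegral.integral_congr zero_le_one hcongr, circleIntegral.integral_sub,
      circleIntegral.integral_sub_center_inv 1 one_ne_zero,
      (hd.mono Metric.closure_ball_subset_closedBall).diffContOnCl.circleIntegral_eq_zero
        zero_le_one, sub_zero]
    · exact ContinuousOn.circleIntegrable zero_le_one
        (ContinuousOn.inv₀ (by fun_prop) fun z hz => (ne_zero_of_mem_sphere hu hz).2)
    · exact ContinuousOn.circleIntegrable zero_le_one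
        (hd.continuousOn.mono Metric.sphere_subset_closedBall)
  · refine circleIntegral.integral_eq_zero_of_hasDerivWithinAt zero_le_one
      (f := fun z => transmissionCoord u z ^ (m + 1) / ((m + 1 : ℤ) : ℂ)) fun z hz => ?_
    obtain ⟨h1, h2⟩ := ne_zero_of_mem_sphere hu hz
    have ht : transmissionCoord u z ≠ 0 := div_ne_zero h2 h1
    have h := ((hasDerivAt_zpow (m + 1) _ (Or.inl ht)).comp z
      (hasDerivAt_transmissionCoord (u := u) h1)).div_const ((m + 1 : ℤ) : ℂ)
    refine HasDerivAt.hasDerivWithinAt (h.congr_deriv ?_)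
    have : ((m + 1 : ℤ) : ℂ) ≠ 0 := Int.cast_ne_zero.2 (by omega)
    rw [add_sub_cancel_right]
    field_simp

theorem transmissionKernel_eq {u : ℝ} (hu : 0 < u) {z : ℂ} (h1 : z + u ≠ 0) (h2 : z - 1 ≠ 0) :
    transmissionKernel u z = (1 + u * transmissionCoord u z) *
      (1 + u * (transmissionCoord u z)⁻¹) / (1 + u) ^ 2 := by
  have hu' : (1 + u : ℂ) ≠ 0 := by
    have : (1 + u : ℝ) ≠ 0 := by positivity
    exact_mod_cast this
  rw [transmissionKernel, transmissionCoord]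
  field_simp
  ring

theorem transmissionKernel_pow_eq {u : ℝ} (hu : 0 < u) (k : ℕ) {z : ℂ} (h1 : z + u ≠ 0)
    (h2 : z - 1 ≠ 0) :
    transmissionKernel u z ^ k = ∑ i ∈ Finset.range (k + 1), ∑ l ∈ Finset.range (k + 1),
      (k.choose i * k.choose l * u ^ (i + l) / (1 + u) ^ (2 * k) : ℂ) *
        transmissionCoord u z ^ ((i : ℤ) - l) := by
  have ht : transmissionCoord u z ≠ 0 := div_ne_zero h2 h1
  rw [transmissionKernel_eq hu h1 h2, div_pow, mul_pow, add_comm (1 : ℂ), add_comm (1 : ℂ), add_pow,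
    add_pow, Finset.sum_mul_sum, Finset.sum_div]
  refine Finset.sum_congr rfl fun i _ => ?_
  rw [Finset.sum_div]
  refine Finset.sum_congr rfl fun l _ => ?_
  rw [zpow_sub₀ ht, zpow_natCast, zpow_natCast, mul_pow, mul_pow, inv_pow, pow_add, ← pow_mul]
  simp only [one_pow, mul_one]
  field_simp

theorem continuousOn_transmissionCoord_zpow_mul {u : ℝ} (hu : 0 < u) (m : ℤ) :
    ContinuousOn (fun z : ℂ => transmissionCoord u z ^ m * ((1 + u) / (z + u) ^ 2))
      (Metric.sphere 1 1) := by
  have h1 : ContinuousOn (transmissionCoord u) (Metric.sphere 1 1) := fun z hz =>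
    (hasDerivAt_transmissionCoord
      (ne_zero_of_mem_sphere hu hz).1).continuousAt.continuousWithinAt
  refine (h1.zpow₀ m fun z hz => Or.inl ?_).mul (ContinuousOn.div (by fun_prop) (by fun_prop) ?_)
  · exact div_ne_zero (ne_zero_of_mem_sphere hu hz).2 (ne_zero_of_mem_sphere hu hz).1
  · exact fun z hz => pow_ne_zero _ (ne_zero_of_mem_sphere hu hz).1

theorem continuousOn_transmissionKernel {u : ℝ} (hu : 0 < u) :
    ContinuousOn (transmissionKernel u) (Metric.sphere 1 1) := fun _ hz =>
  (hasDerivAt_transmissionKernel (ne_zero_of_mem_sphere hu hz).1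
    (ne_zero_of_mem_sphere hu hz).2).continuousAt.continuousWithinAt

theorem circleIntegral_transmissionKernel_pow {u : ℝ} (hu : 0 < u) (k : ℕ) (m : ℤ) :
    ∮ z in C(1, 1), transmissionKernel u z ^ k *
        (transmissionCoord u z ^ m * ((1 + u) / (z + u) ^ 2)) =
      2 * Real.pi * Complex.I * ((∑ i ∈ Finset.range (k + 1), ∑ l ∈ Finset.range (k + 1),
        if (i : ℤ) - l + m = -1 then (k.choose i * k.choose l * u ^ (i + l) : ℝ) else 0 : ℝ) /
          (1 + u) ^ (2 * k)) := by
  have hcongr : Set.EqOn (fun z : ℂ => transmissionKernel u z ^ k *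
      (transmissionCoord u z ^ m * ((1 + u) / (z + u) ^ 2)))
      (fun z => ∑ i ∈ Finset.range (k + 1), ∑ l ∈ Finset.range (k + 1),
        (k.choose i * k.choose l * u ^ (i + l) / (1 + u) ^ (2 * k) : ℂ) *
          (transmissionCoord u z ^ ((i : ℤ) - l + m) * ((1 + u) / (z + u) ^ 2)))
      (Metric.sphere 1 1) := by
    intro z hz
    obtain ⟨h1, h2⟩ := ne_zero_of_mem_sphere hu hz
    have ht : transmissionCoord u z ≠ 0 := div_ne_zero h2 h1
    simp only
    rw [transmissionKernel_pow_eq hu k h1 h2, Finset.sum_mul]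
    refine Finset.sum_congr rfl fun i _ => ?_
    rw [Finset.sum_mul]
    refine Finset.sum_congr rfl fun l _ => ?_
    rw [zpow_add₀ ht _ m]
    ring
  have hint : ∀ i l : ℕ, CircleIntegrable (fun z : ℂ =>
      (k.choose i * k.choose l * u ^ (i + l) / (1 + u) ^ (2 * k) : ℂ) *
        (transmissionCoord u z ^ ((i : ℤ) - l + m) * ((1 + u) / (z + u) ^ 2))) 1 1 := fun i l =>
    (continuousOn_const.mul
      (continuousOn_transmissionCoord_zpow_mul hu _)).circleIntegrable zero_le_one
  rw [circleIntegral.integral_congr zero_le_one hcongr, circleIntegral.integral_fun_sum fun i _ =>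
    CircleIntegrable.fun_sum _ fun l _ => hint i l]
  push_cast
  rw [Finset.sum_div, Finset.mul_sum]
  refine Finset.sum_congr rfl fun i _ => ?_
  rw [circleIntegral.integral_fun_sum fun l _ => hint i l, Finset.sum_div, Finset.mul_sum]
  refine Finset.sum_congr rfl fun l _ => ?_
  rw [circleIntegral.integral_const_mul, circleIntegral_transmissionCoord_zpow hu]
  split_ifs
  · push_cast
    ring
  · simp

theorem circleIntegral_kernel_pow_neg_one {u : ℝ} (hu : 0 < u) (k : ℕ) :
    ∮ z in C(1, 1), transmissionKernel u z ^ k *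
        (transmissionCoord u z ^ (-1 : ℤ) * ((1 + u) / (z + u) ^ 2)) =
      2 * Real.pi * Complex.I * (centralSum k u / (1 + u) ^ (2 * k)) := by
  rw [circleIntegral_transmissionKernel_pow hu, centralSum]
  refine congrArg (fun x : ℝ => 2 * Real.pi * Complex.I * ((x : ℂ) / (1 + u) ^ (2 * k)))
    (Finset.sum_congr rfl fun i hi => ?_)
  rw [Finset.sum_eq_single i]
  · rw [if_pos (by ring)]
    ring
  · exact fun l _ hl => if_neg (by omega)
  · exact fun h => absurd hi h

theorem circleIntegral_kernel_pow_zero {u : ℝ} (hu : 0 < u) (k : ℕ) :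
    ∮ z in C(1, 1), transmissionKernel u z ^ k *
        (transmissionCoord u z ^ (0 : ℤ) * ((1 + u) / (z + u) ^ 2)) =
      2 * Real.pi * Complex.I * (narayanaSum k u / (1 + u) ^ (2 * k)) := by
  rw [circleIntegral_transmissionKernel_pow hu, narayanaSum]
  refine congrArg (fun x : ℝ => 2 * Real.pi * Complex.I * ((x : ℂ) / (1 + u) ^ (2 * k)))
    (Finset.sum_congr rfl fun i hi => ?_)
  rw [Finset.sum_eq_single (i + 1)]
  · rw [if_pos (by push_cast; ring)]
    ring
  · exact fun l _ hl => if_neg (by omega)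
  · intro h
    rw [Nat.choose_eq_zero_of_lt (show k < i + 1 by have := Finset.mem_range.not.1 h; omega)]
    simp

theorem circleIntegral_kernel_pow_neg_two {u : ℝ} (hu : 0 < u) (k : ℕ) :
    ∮ z in C(1, 1), transmissionKernel u z ^ k *
        (transmissionCoord u z ^ (-2 : ℤ) * ((1 + u) / (z + u) ^ 2)) =
      2 * Real.pi * Complex.I * (narayanaSum k u / (1 + u) ^ (2 * k)) := by
  rw [circleIntegral_transmissionKernel_pow hu, narayanaSum, Finset.sum_comm]
  refine congrArg (fun x : ℝ => 2 * Real.pi * Complex.I * ((x : ℂ) / (1 + u) ^ (2 * k)))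
    (Finset.sum_congr rfl fun i hi => ?_)
  rw [Finset.sum_eq_single (i + 1)]
  · rw [if_pos (by push_cast; ring)]
    ring
  · exact fun l _ hl => if_neg (by omega)
  · intro h
    rw [Nat.choose_eq_zero_of_lt (show k < i + 1 by have := Finset.mem_range.not.1 h; omega)]
    simp

/-- Integration by parts lowers K^(k+1) dz to K^k times a Laurent polynomial in t, from which
coefficients can be read off. -/
theorem circleIntegral_transmissionKernel_pow_succ {u : ℝ} (hu : 0 < u) (k : ℕ) :
    1 / ((k + 1 : ℕ) : ℂ) * (2 * Real.pi * Complex.I)⁻¹ *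
        ∮ z in C(1, 1), transmissionKernel u z ^ (k + 1) =
      (u * (centralSum k u + narayanaSum k u) / (u + 1) ^ (2 * k + 1) : ℝ) := by
  have hk : ((k + 1 : ℕ) : ℂ) ≠ 0 := Nat.cast_ne_zero.2 k.succ_ne_zero
  have hu' : (1 + u : ℂ) ≠ 0 := by
    have : (1 + u : ℝ) ≠ 0 := by positivity
    exact_mod_cast this
  have hpi : (2 * Real.pi * Complex.I : ℂ) ≠ 0 := Complex.two_pi_I_ne_zero
  have hKc := continuousOn_transmissionKernel hu
  have hI : ∀ m : ℤ, ContinuousOn (fun z : ℂ => transmissionKernel u z ^ k *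
      (transmissionCoord u z ^ m * ((1 + u) / (z + u) ^ 2))) (Metric.sphere 1 1) := fun m =>
    (hKc.pow k).mul (continuousOn_transmissionCoord_zpow_mul hu m)
  have hsum : ∮ z in C(1, 1), ((k + 1 : ℕ) : ℂ)⁻¹ * transmissionKernel u z ^ (k + 1) -
      (u / (2 * (1 + u)) : ℂ) * (transmissionKernel u z ^ k *
        (transmissionCoord u z ^ (-2 : ℤ) * ((1 + u) / (z + u) ^ 2)) +
      2 * (transmissionKernel u z ^ k *
        (transmissionCoord u z ^ (-1 : ℤ) * ((1 + u) / (z + u) ^ 2))) +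
      transmissionKernel u z ^ k *
        (transmissionCoord u z ^ (0 : ℤ) * ((1 + u) / (z + u) ^ 2))) = 0 := by
    refine circleIntegral.integral_eq_zero_of_hasDerivWithinAt zero_le_one
      -- The constant (u-1)/2 centres z at the fixed point of z ↦ 1 - u - z, which is t ↦ 1/t. This
      -- makes (z + (u-1)/2) dK the symmetric form -u/(2(1+u)) · (t⁻² + 2t⁻¹ + 1) dt.
      (f := fun z => (z + (u - 1) / 2) * transmissionKernel u z ^ (k + 1) / ((k + 1 : ℕ) : ℂ))
      fun z hz => ?_
    obtain ⟨h1, h2⟩ := ne_zero_of_mem_sphere hu hz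
    have hd : HasDerivAt (fun z : ℂ => z + ((u : ℂ) - 1) / 2) 1 z := (hasDerivAt_id z).add_const _
    have h := (hd.mul ((hasDerivAt_transmissionKernel (u := u) h1 h2).fun_pow (k + 1))).div_const
      ((k + 1 : ℕ) : ℂ)
    refine HasDerivAt.hasDerivWithinAt (h.congr_deriv ?_)
    rw [Nat.add_sub_cancel]
    have hrat : (z + ((u : ℂ) - 1) / 2) *
        (((z + (z + u - 1)) * ((z + u) * (z - 1)) - (z + u - 1) * z * (z - 1 + (z + u))) /
          ((z + u) * (z - 1)) ^ 2) = -(u / (2 * (1 + u)) : ℂ) *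
        ((transmissionCoord u z ^ (-2 : ℤ) + 2 * transmissionCoord u z ^ (-1 : ℤ) + 1) *
          ((1 + u) / (z + u) ^ 2)) := by
      rw [show (-2 : ℤ) = -((2 : ℕ) : ℤ) by rfl, zpow_neg, zpow_natCast, zpow_neg_one,
        transmissionCoord]
      field_simp
      ring
    rw [zpow_zero]
    calc _ = ((k + 1 : ℕ) : ℂ)⁻¹ * transmissionKernel u z ^ (k + 1) +
          transmissionKernel u z ^ k * ((z + ((u : ℂ) - 1) / 2) *
        (((z + (z + u - 1)) * ((z + u) * (z - 1)) - (z + u - 1) * z * (z - 1 + (z + u))) /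
          ((z + u) * (z - 1)) ^ 2)) := by
          field_simp
      _ = _ := by
          rw [hrat]
          ring
  rw [circleIntegral.integral_sub, circleIntegral.integral_const_mul,
    circleIntegral.integral_const_mul, circleIntegral.integral_add, circleIntegral.integral_add,
    circleIntegral.integral_const_mul, circleIntegral_kernel_pow_neg_one hu,
    circleIntegral_kernel_pow_neg_two hu, circleIntegral_kernel_pow_zero hu, sub_eq_zero] at hsum
  · rw [one_div, mul_right_comm, hsum]
    have hu'' : (u + 1 : ℂ) ≠ 0 := by rwa [add_comm]
    push_cast
    rw [add_comm (1 : ℂ) u]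
    field_simp
    ring
  · exact (hI _).circleIntegrable zero_le_one
  · exact (continuousOn_const.mul (hI _)).circleIntegrable zero_le_one
  · exact ((hI _).add (continuousOn_const.mul (hI _))).circleIntegrable zero_le_one
  · exact (hI _).circleIntegrable zero_le_one
  · exact (continuousOn_const.mul (hKc.pow _)).circleIntegrable zero_le_one
  · exact (continuousOn_const.mul (((hI _).add (continuousOn_const.mul (hI _))).add
      (hI _))).circleIntegrable zero_le_one

/-- Taking the difference helps because 1 - K = -u/((z+u)(z-1)): then (1 - K)/(z+u) dz is a multiple
of (t⁻¹ - 1) dt, and the two coefficients are A_k and B_k. -/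
theorem circleIntegral_transmissionKernel_pow_div_sub {u : ℝ} (hu : 0 < u) (k : ℕ) :
    (2 * Real.pi * Complex.I)⁻¹ * (∮ z in C(1, 1), transmissionKernel u z ^ k / (z + u)) -
        (2 * Real.pi * Complex.I)⁻¹ * (∮ z in C(1, 1), transmissionKernel u z ^ (k + 1) / (z + u)) =
      (-(u * (centralSum k u - narayanaSum k u) / (u + 1) ^ (2 * k + 2)) : ℝ) := by
  have hu' : (1 + u : ℂ) ≠ 0 := by
    have : (1 + u : ℝ) ≠ 0 := by positivity
    exact_mod_cast this
  have hpi : (2 * Real.pi * Complex.I : ℂ) ≠ 0 := Complex.two_pi_I_ne_zero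
  have hKc := continuousOn_transmissionKernel hu
  have hI : ∀ m : ℤ, CircleIntegrable (fun z : ℂ => transmissionKernel u z ^ k *
      (transmissionCoord u z ^ m * ((1 + u) / (z + u) ^ 2))) 1 1 := fun m =>
    ((hKc.pow k).mul (continuousOn_transmissionCoord_zpow_mul hu m)).circleIntegrable zero_le_one
  have hJ : ∀ j : ℕ, CircleIntegrable (fun z : ℂ => transmissionKernel u z ^ j / (z + u)) 1 1 :=
    fun j => ((hKc.pow j).div (by fun_prop) fun z hz =>
      (ne_zero_of_mem_sphere hu hz).1).circleIntegrable zero_le_one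
  have hcongr : Set.EqOn (fun z : ℂ => transmissionKernel u z ^ k / (z + u) -
      transmissionKernel u z ^ (k + 1) / (z + u)) (fun z => -(u / (1 + u) ^ 2 : ℂ) *
      (transmissionKernel u z ^ k *
        (transmissionCoord u z ^ (-1 : ℤ) * ((1 + u) / (z + u) ^ 2)) -
      transmissionKernel u z ^ k *
        (transmissionCoord u z ^ (0 : ℤ) * ((1 + u) / (z + u) ^ 2)))) (Metric.sphere 1 1) := by
    intro z hz
    obtain ⟨h1, h2⟩ := ne_zero_of_mem_sphere hu hz
    have hrat : (1 - transmissionKernel u z) / (z + u) = -(u / (1 + u) ^ 2 : ℂ) *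
        ((transmissionCoord u z ^ (-1 : ℤ) - transmissionCoord u z ^ (0 : ℤ)) *
          ((1 + u) / (z + u) ^ 2)) := by
      rw [zpow_neg_one, zpow_zero, transmissionCoord, transmissionKernel]
      field_simp
      ring
    simp only
    calc _ = transmissionKernel u z ^ k * ((1 - transmissionKernel u z) / (z + u)) := by ring
      _ = _ := by
        rw [hrat]
        ring
  rw [← mul_sub, ← circleIntegral.integral_sub (hJ _) (hJ _),
    circleIntegral.integral_congr zero_le_one hcongr, circleIntegral.integral_const_mul,
    circleIntegral.integral_sub (hI _) (hI _), circleIntegral_kernel_pow_neg_one hu,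
    circleIntegral_kernel_pow_zero hu]
  have hu'' : (u + 1 : ℂ) ≠ 0 := by rwa [add_comm]
  push_cast
  rw [add_comm (1 : ℂ) u]
  field_simp
  ring

end QuantumTransport

end

theorem mainTheorem3 :
    (∀ (k : ℕ) (w : ℝ), 1 ≤ k → 1 < w →
      (∀ᶠ n : ℕ in atTop,
        IntegrableOn (fun x : Fin n → ℝ =>
          QuantumTransport.laguerreWeight 2 (QuantumTransport.laguerreB 2 w n) x)
          (QuantumTransport.laguerreDomain n) ∧
        IntegrableOn (fun x : Fin n → ℝ =>
          (∑ j, x j ^ (-(k : ℤ))) *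
            QuantumTransport.laguerreDensity 2 (QuantumTransport.laguerreB 2 w n) x)
          (QuantumTransport.laguerreDomain n)) ∧
      QuantumTransport.HasAsymptoticExpansion (QuantumTransport.delaySeq 2 k w)
        (fun p => QuantumTransport.delayCoeff 2 k p w) ∧
      QuantumTransport.delayCoeff 2 k 1 w = 0) ∧
    (∀ (k : ℕ) (u δ : ℝ), 1 ≤ k → 1 < u → δ ∈ ({-1, 0, 1, 2} : Set ℝ) →
      (∀ᶠ n : ℕ in atTop,
        IntegrableOn (fun x : Fin n → ℝ =>
          QuantumTransport.jacobiWeight 2 (QuantumTransport.jacobiA 2 δ)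
            (QuantumTransport.jacobiB u n) x)
          (QuantumTransport.jacobiDomain n) ∧
        IntegrableOn (fun x : Fin n → ℝ =>
          (∑ j, x j ^ k) *
            QuantumTransport.jacobiDensity 2 (QuantumTransport.jacobiA 2 δ)
              (QuantumTransport.jacobiB u n) x)
          (QuantumTransport.jacobiDomain n)) ∧
      QuantumTransport.HasAsymptoticExpansion (QuantumTransport.transmissionSeq 2 δ k u)
        (fun p => QuantumTransport.transmissionCoeff 2 δ k p u) ∧
      QuantumTransport.transmissionCoeff 2 δ k 0 u = QuantumTransport.transmissionLeading k u ∧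
      QuantumTransport.transmissionDiffCoeff 2 δ k 1 u =
        δ / (2 * (u - 1)) * ((u - 1) / (u + 1)) ^ (2 * k + 2) *
          QuantumTransport.transmissionLeading (k + 1) (-u)) := by

  refine ⟨fun k w hk hw => ⟨?_, QuantumTransport.delay_expansion hk hw⟩,
    fun k u δ hk hu hδ => ?_⟩
  · have hlarge : ∀ᶠ n : ℕ in atTop, (k : ℝ) < n * (w - 1) + 1 :=
      (tendsto_atTop_add_const_right _ _ (tendsto_natCast_atTop_atTop.atTop_mul_const
        (by linarith : 0 < w - 1))).eventually_gt_atTop _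
    filter_upwards [hlarge] with n hn
    have hb : (k : ℝ) < QuantumTransport.laguerreB 2 w n + 1 := by
      rw [QuantumTransport.laguerreB]
      linarith
    have h := QuantumTransport.laguerre_moment_formula (n := n) hb
    exact ⟨h.1, h.2.1⟩
  · have hδ2 : -2 < δ ∧ δ ≤ 2 := by
      rcases hδ with rfl | rfl | rfl | rfl <;> norm_num
    obtain ⟨hδl, hδu⟩ := hδ2
    -- The closed forms give the leading coefficient at index j + 1 in terms of A_j and B_j, whereas
    -- the first-order difference uses A_{j+1} and B_{j+1}.
    obtain ⟨j, rfl⟩ : ∃ j, k = j + 1 := ⟨k - 1, by omega⟩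
    have hu0 : 0 < u := by linarith
    have hE := QuantumTransport.transmission_expansion hk hu hδl hδu
    have hE' := QuantumTransport.transmission_expansion (k := j + 1 + 1) (by omega) hu hδl hδu
    refine ⟨Eventually.of_forall fun n => ?_, hE.1, ?_, ?_⟩
    · have h := QuantumTransport.jacobi_moment_formula (a := QuantumTransport.jacobiA 2 δ)
        (b := QuantumTransport.jacobiB u n) (k := j + 1) (n := n)
        (by rw [QuantumTransport.jacobiA]; linarith)
        (by
          have : 0 ≤ QuantumTransport.jacobiB u n := mul_nonneg (by positivity) (by linarith)
          linarith)
      exact ⟨h.1, h.2.1⟩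
    · rw [hE.2.1, QuantumTransport.circleIntegral_transmissionKernel_pow_succ hu0,
        Complex.ofReal_re, QuantumTransport.transmissionLeading_succ (by positivity)]
    -- Parity in u turns the leading coefficient at -u into -u(A - B) over an odd power of 1 - u;
    -- the powers of u - 1 in the claimed formula cancel that denominator and its sign.
    · rw [QuantumTransport.transmissionDiffCoeff, hE.2.2, hE'.2.2, ← Complex.sub_re,
        mul_assoc (-((δ : ℂ) / 2)), mul_assoc (-((δ : ℂ) / 2)), ← mul_sub, QuantumTransport.circleIntegral_transmissionKernel_pow_div_sub hu0,
        show (-((δ : ℂ) / 2)) = ((-(δ / 2) : ℝ) : ℂ) by push_cast; ring, ← Complex.ofReal_mul,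
        Complex.ofReal_re, QuantumTransport.transmissionLeading_succ (by linarith),
        QuantumTransport.centralSum_neg, QuantumTransport.narayanaSum_neg, div_pow,
        show (-u + 1) ^ (2 * (j + 1) + 1) = -(u - 1) ^ (2 * (j + 1) + 1) by
          rw [← Odd.neg_pow ⟨j + 1, rfl⟩]; ring]
      have h1 : u - 1 ≠ 0 := by linarith
      have h2 : u + 1 ≠ 0 := by linarith
      rw [pow_succ (u - 1) (2 * (j + 1)), show 2 * (j + 1) + 2 = 2 * (j + 1) + 1 + 1 by rfl,
        pow_succ (u - 1) (2 * (j + 1) + 1), pow_succ (u - 1) (2 * (j + 1))]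
      field_simp
      ring
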